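/- Conventions. All objects are finite. Let $\phi$ be a closure operator on the subsets of a finite set $U$; a set $C\subseteq U$ is closed if $\phi(C)=C$. The closure system is a \emph{convex geometry} if $\emptyset$ is closed and for every closed $C\neq U$ there is $x\in U\setminus C$ such that $C\cup\{x\}$ is closed. A set $Q\subseteq U$ is \emph{quasi-closed} if it is not closed and, for every $A\subseteq Q$, $\phi(A)\subsetneq\phi(Q)$ implies $\phi(A)\subseteq Q$; it is then called a quasi-closed set of $C=\phi(Q)$, and $C$ is called \emph{essential}. The \emph{quasi-closed hypergraph} of an essential set $C$ has vertex set $C$ and edges $C\setminus Q$, where $Q$ ranges over the inclusion-wise maximal quasi-closed sets of $C$. An \emph{implicational base} of the closure system is a set $\Sigma$ of implications $A\to B$ with $A,B\subseteq U$ such that a set $C\subseteq U$ is closed if and only if, for every $A\to B$ in $\Sigma$, $A\subseteq C$ implies $B\subseteq C$. A base is \emph{minimum} if it has the least number of implications, and \emph{optimum} if it has the least total size $\sum_{A\to B\in\Sigma}(|A|+|B|)$, among all implicational bases of the same closure system. It is \emph{reduced} if it ceases to be a base of the closure system whenever the premise of one of its implications, or the conclusion of one of its implications, is replaced by a proper subset.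 Theorem. An implicational base of a convex geometry in which each quasi-closed hypergraph has pairwise disjoint edges can be optimized in polynomial time. That is: there is one deterministic polynomial-time algorithm (a Turing machine, with running time polynomial in the length of the input, which consists of the ground set $U=\{0,\dots,n-1\}$, written in unary, and a list of implications over $U$, each written as the characteristic words of its premise and of its conclusion) which, whenever the input is an implicational base of a convex geometry such that the edges of each of its quasi-closed hypergraphs are pairwise disjoint, outputs an optimum implicational base of the same convex geometry. Moreover, in every such convex geometry, every implicational base that is minimum and reduced is optimum. -/

import Mathlib

namespace ImplicationalBase

/-- An implication `A → B` over the ground set `U`. -/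
@[ext]
structure Implication (U : Type*) where
  /-- the premise `A` -/
  premise : Finset U
  /-- the conclusion `B` -/
  conclusion : Finset U
  deriving DecidableEq

variable {U : Type*}

/-- `C` satisfies `A → B` if `A ⊆ C` implies `B ⊆ C`. -/
def Implication.Satisfies (C : Finset U) (i : Implication U) : Prop :=
  i.premise ⊆ C → i.conclusion ⊆ C

/-- The finite collection `S` of implications is an implicational base of the closure system on `U`
with closure operator `φ`: the closed sets are exactly the sets that satisfy `S`. -/
def IsBase (φ : ClosureOperator (Finset U)) (S : Finset (Implication U)) : Prop :=
  ∀ C : Finset U, φ.IsClosed C ↔ ∀ i ∈ S, i.Satisfies C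

/-- The total size: the sum of the sizes of all premises and conclusions. -/
def totalSize (S : Finset (Implication U)) : ℕ :=
  ∑ i ∈ S, (i.premise.card + i.conclusion.card)

/-- A base with the least number of implications among all bases of the closure system. -/
def IsMinimumBase (φ : ClosureOperator (Finset U)) (S : Finset (Implication U)) : Prop :=
  IsBase φ S ∧ ∀ S' : Finset (Implication U), IsBase φ S' → S.card ≤ S'.card

/-- A base with the least total size among all bases of the closure system. -/
def IsOptimumBase (φ : ClosureOperator (Finset U)) (S : Finset (Implication U)) : Prop :=
  IsBase φ S ∧ ∀ S' : Finset (Implication U), IsBase φ S' → totalSize S ≤ totalSize S'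

/-- No premise can be replaced by a proper subset of it. -/
def IsLeftReduced [DecidableEq U] (φ : ClosureOperator (Finset U)) (S : Finset (Implication U)) :
    Prop :=
  ∀ i ∈ S, ∀ A' : Finset U, A' ⊂ i.premise → ¬ IsBase φ (insert ⟨A', i.conclusion⟩ (S.erase i))

/-- No conclusion can be replaced by a proper subset of it. -/
def IsRightReduced [DecidableEq U] (φ : ClosureOperator (Finset U)) (S : Finset (Implication U)) :
    Prop :=
  ∀ i ∈ S, ∀ B' : Finset U, B' ⊂ i.conclusion → ¬ IsBase φ (insert ⟨i.premise, B'⟩ (S.erase i))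

/-- A convex geometry: the empty set is closed, and every closed set other than the ground set
can be extended by one element to a closed set. -/
def IsConvexGeometry [Fintype U] [DecidableEq U] (φ : ClosureOperator (Finset U)) : Prop :=
  φ.IsClosed ∅ ∧
    ∀ C : Finset U, φ.IsClosed C → C ≠ Finset.univ → ∃ x, x ∉ C ∧ φ.IsClosed (insert x C)

/-- `Q` is quasi-closed: it is not closed, and it contains the closure of each of its subsets
whose closure is a proper subset of the closure of `Q`. -/
def IsQuasiClosed (φ : ClosureOperator (Finset U)) (Q : Finset U) : Prop :=
  ¬ φ.IsClosed Q ∧ ∀ A : Finset U, A ⊆ Q → φ A ⊂ φ Q → φ A ⊆ Q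

/-- `Q` is a quasi-closed set of `C`, that is, a quasi-closed set that spans `C`. -/
def IsQuasiClosedOf (φ : ClosureOperator (Finset U)) (C Q : Finset U) : Prop :=
  IsQuasiClosed φ Q ∧ φ Q = C

/-- `C` is essential: it is the closure of a quasi-closed set. -/
def IsEssential (φ : ClosureOperator (Finset U)) (C : Finset U) : Prop :=
  ∃ Q : Finset U, IsQuasiClosedOf φ C Q

/-- The quasi-closed hypergraph of `C`: its vertices are the elements of `C`, its edges are the
complements in `C` of the inclusion-wise maximal quasi-closed sets of `C`. -/
def qcHypergraph (φ : ClosureOperator (Finset U)) (C : Finset U) : Hypergraph U where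
  vertexSet := C
  edgeSet := {E | ∃ Q : Finset U, Maximal (IsQuasiClosedOf φ C) Q ∧ E = (C : Set U) \ Q}
  subset_vertexSet_of_mem_edgeSet' := by
    rintro E ⟨Q, -, rfl⟩
    exact Set.sdiff_subset

/-- For every essential set, distinct edges of its quasi-closed hypergraph are disjoint. -/
def HasDisjointQCHypergraphs (φ : ClosureOperator (Finset U)) : Prop :=
  ∀ C : Finset U, IsEssential φ C → (qcHypergraph φ C).edgeSet.PairwiseDisjoint id

open Computability (Γ')

/-- A subset of `{0, …, n - 1}` written as its characteristic word of length `n`. -/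
def encodeSet {n : ℕ} (A : Finset (Fin n)) : List Γ' :=
  List.ofFn fun x : Fin n => Γ'.bit (decide (x ∈ A))

/-- An implication written as `[A,B]`. -/
def encodeImplication {n : ℕ} (i : Implication (Fin n)) : List Γ' :=
  Γ'.bra :: encodeSet i.premise ++ Γ'.comma :: encodeSet i.conclusion ++ [Γ'.ket]

/-- The word that presents to a Turing machine the ground set `{0, …, n - 1}` (in unary) together
with a list of implications. -/
def encodeBase (b : (n : ℕ) × List (Implication (Fin n))) : List Γ' :=
  List.replicate b.1 Γ'.blank ++ b.2.flatMap encodeImplication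

theorem encodeSet_injective {n : ℕ} : Function.Injective (encodeSet (n := n)) := by
  intro A B h
  have h' := List.ofFn_injective h
  ext x
  simpa using congrFun h' x

theorem length_encodeSet {n : ℕ} (A : Finset (Fin n)) : (encodeSet A).length = n := by
  simp [encodeSet]

/-- The encoding loses no information. -/
theorem encodeBase_injective : Function.Injective encodeBase := by
  have hnb : ∀ {n : ℕ} (L : List (Implication (Fin n))),
      Γ'.blank ∉ L.flatMap encodeImplication := by
    intro n L
    simp [encodeImplication, encodeSet, List.mem_ofFn]
  have hL : ∀ (n : ℕ) (L L' : List (Implication (Fin n))),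
      L.flatMap encodeImplication = L'.flatMap encodeImplication → L = L' := by
    intro n L
    induction L with
    | nil => intro L' h; cases L' <;> simp_all [encodeImplication]
    | cons i L ih =>
      intro L' h
      cases L' with
      | nil => simp [encodeImplication] at h
      | cons j L' =>
        simp only [List.flatMap_cons, encodeImplication, List.cons_append, List.append_assoc,
          List.cons.injEq, true_and] at h
        obtain ⟨h1, h2⟩ := List.append_inj h (by simp [length_encodeSet])
        simp only [List.cons.injEq, true_and] at h2
        obtain ⟨h3, h4⟩ := List.append_inj h2 (by simp [length_encodeSet])
        simp only [List.nil_append, List.cons.injEq, true_and] at h4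
        rw [ih L' h4, Implication.ext (encodeSet_injective h1) (encodeSet_injective h3)]
  rintro ⟨n, L⟩ ⟨n', L'⟩ h
  have hn : n = n' := by
    have := congrArg (List.count Γ'.blank) h
    simpa [encodeBase, List.count_eq_zero.2 (hnb L), List.count_eq_zero.2 (hnb L')] using this
  subst hn
  rw [hL n L L' (List.append_cancel_left h)]

end ImplicationalBase

open ImplicationalBase

/-!
# Optimizing implicational bases of convex geometries

In a convex geometry every closed set `C` has a smallest spanning set, the set of its extreme points
(`IsConvexGeometry.closure_extremePoints`). Hence all quasi-closed sets of `C` contain the extreme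
points. Every base leaves every quasi-closed set `Q` of `C` by means of an implication whose premise
spans `C` and whose conclusion is not inside `Q` (`IsBase.exists_mem`), and sound implications with
this property form a base (`isBase_of_forall`). So the implications of a base whose premise spans an
essential set `C` contain at least one premise as large as the set of extreme points of `C`, and
their conclusions together form a transversal of the quasi-closed hypergraph of `C`. If the edges of
this hypergraph are disjoint, an inclusion-minimal transversal has exactly as many elements as there
are edges, and no transversal is smaller (`IsTransversal.card_le`). Therefore a base is optimum if
it has one implication for each essential set, from the extreme points to an inclusion-minimal
transversal (`isOptimumBase_of_forall`); minimum reduced bases are of this kind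
(`IsMinimumBase.isOptimumBase`).

The algorithm `optimize` finds such a base. A set `T ⊆ C` is a transversal if and only if the
saturation of `T` together with the extreme points of `C`, under those implications whose premise
spans less than `C`, is `C` (`saturate_subset_of_isQuasiClosedOf`, `isQuasiClosedOf_saturate`). In a
convex geometry these implications are recognized by a premise that does not contain all extreme
points of `C`. So a greedy procedure that starts with `C` yields a minimal transversal
(`shrink_spec`), which is empty exactly if `C` is not essential. Every essential set is the closure
of a premise of the given base, so it suffices to handle these closures.

For the running time, a small language of programs with loops over stacks is compiled to the Turing
machines `Turing.TM2` with an exact count of the steps (`Exec.steps`). The program for `optimize`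
stores the sets of the algorithm as the tracks of one word over the ground set, which is traversed
in parallel with the implications; as each traversal reverses the words, it is followed by one in
the other direction.
-/

namespace ImplicationalBase

section ClosureSystem

/-! ### Quasi-closed sets and implicational bases -/

variable {U : Type*} {φ : ClosureOperator (Finset U)} {S : Finset (Implication U)}
  {C D Q T : Finset U}

/-- `T` is not inside any quasi-closed set of `C`; for `T ⊆ C` this says that `T` is a transversal
of the quasi-closed hypergraph of `C`. -/
def IsTransversal (φ : ClosureOperator (Finset U)) (C T : Finset U) : Prop :=
  ∀ Q, IsQuasiClosedOf φ C Q → ¬ T ⊆ Q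

theorem IsTransversal.mono {T' : Finset U} (h : IsTransversal φ C T) (hT : T ⊆ T') :
    IsTransversal φ C T' := fun Q hQ hT' => h Q hQ (hT.trans hT')

theorem IsQuasiClosedOf.isClosed (hQ : IsQuasiClosedOf φ C Q) : φ.IsClosed C :=
  hQ.2 ▸ φ.isClosed_closure Q

theorem IsQuasiClosedOf.subset (hQ : IsQuasiClosedOf φ C Q) : Q ⊆ C := hQ.2 ▸ φ.le_closure Q

theorem isTransversal_self : IsTransversal φ C C := fun _ hQ h =>
  hQ.1.1 (h.antisymm hQ.subset ▸ hQ.isClosed)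

theorem IsBase.conclusion_subset (hS : IsBase φ S) {i : Implication U} (hi : i ∈ S) :
    i.conclusion ⊆ φ i.premise :=
  (hS _).1 (φ.isClosed_closure _) i hi (φ.le_closure _)

/-- Every base leaves every quasi-closed set by means of an implication whose premise spans the
same closed set. -/
theorem IsBase.exists_mem (hS : IsBase φ S) (hQ : IsQuasiClosedOf φ C Q) :
    ∃ i ∈ S, φ i.premise = C ∧ i.premise ⊆ Q ∧ ¬ i.conclusion ⊆ Q := by
  have h := mt (hS Q).2 hQ.1.1
  simp only [Implication.Satisfies, not_forall, exists_prop] at h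
  obtain ⟨i, hi, hsat⟩ := h
  refine ⟨i, hi, ?_, hsat⟩
  by_contra hne
  have hsub : φ i.premise ⊆ C := hQ.2 ▸ φ.monotone hsat.1
  exact hsat.2 ((hS.conclusion_subset hi).trans
    (hQ.1.2 _ hsat.1 (hQ.2.symm ▸ lt_of_le_of_ne hsub hne)))

variable [DecidableEq U]

/-! ### Extreme points of convex geometries -/

theorem isClosed_inter {A B : Finset U} (hA : φ.IsClosed A) (hB : φ.IsClosed B) :
    φ.IsClosed (A ∩ B) := by
  rw [φ.isClosed_iff_closure_le]
  exact Finset.subset_inter (φ.closure_min Finset.inter_subset_left hA)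
    (φ.closure_min Finset.inter_subset_right hB)

/-- The extreme points of `C`: the elements whose removal from `C` leaves a closed set. -/
noncomputable def extremePoints (φ : ClosureOperator (Finset U)) (C : Finset U) : Finset U := by
  classical exact C.filter fun x => φ.IsClosed (C.erase x)

theorem mem_extremePoints {x : U} : x ∈ extremePoints φ C ↔ x ∈ C ∧ φ.IsClosed (C.erase x) := by
  simp [extremePoints]

theorem extremePoints_subset : extremePoints φ C ⊆ C := fun _ hx => (mem_extremePoints.1 hx).1

theorem extremePoints_subset_of_closure_eq {A : Finset U} (h : φ A = C) :
    extremePoints φ C ⊆ A := by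
  intro x hx
  obtain ⟨hxC, hcl⟩ := mem_extremePoints.1 hx
  by_contra hxA
  have hA : A ⊆ C.erase x := fun y hy =>
    Finset.mem_erase.2 ⟨fun e => hxA (e ▸ hy), h ▸ φ.le_closure A hy⟩
  exact (Finset.mem_erase.1 (φ.closure_min hA hcl (h.symm ▸ hxC))).1 rfl

variable [Fintype U]

/-- A closed set `C` not inside the closed set `D` has an extreme point outside `D`: in a chain of
closed sets that grows from `D` one element at a time, consider the step that completes `C`. -/
theorem IsConvexGeometry.exists_mem_extremePoints (hφ : IsConvexGeometry φ) (hC : φ.IsClosed C)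
    (hD : φ.IsClosed D) (h : ¬ C ⊆ D) : ∃ x ∈ extremePoints φ C, x ∉ D := by
  induction hk : Dᶜ.card using Nat.strong_induction_on generalizing D with
  | _ k ih =>
    obtain ⟨y, hyD, hy⟩ := hφ.2 D hD fun e => h (e ▸ Finset.subset_univ C)
    by_cases hCy : C ⊆ insert y D
    · have hyC : y ∈ C := by
        by_contra hyC
        exact h fun z hz => (Finset.mem_insert.1 (hCy hz)).resolve_left fun e => hyC (e ▸ hz)
      refine ⟨y, mem_extremePoints.2 ⟨hyC, ?_⟩, hyD⟩
      have : C.erase y = C ∩ D := by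
        ext z
        have := @hCy z
        simp only [Finset.mem_erase, Finset.mem_inter, Finset.mem_insert] at this ⊢
        constructor
        · rintro ⟨h1, h2⟩
          exact ⟨h2, (this h2).resolve_left h1⟩
        · rintro ⟨h1, h2⟩
          exact ⟨fun e => hyD (e ▸ h2), h1⟩
      exact this ▸ isClosed_inter hC hD
    · obtain ⟨x, hx, hxD⟩ := ih _ (by
        rw [← hk]
        apply Finset.card_lt_card
        rw [Finset.compl_ssubset_compl]
        exact Finset.ssubset_insert hyD) hy hCy rfl
      exact ⟨x, hx, fun h => hxD (Finset.mem_insert_of_mem h)⟩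

theorem IsConvexGeometry.closure_extremePoints (hφ : IsConvexGeometry φ) (hC : φ.IsClosed C) :
    φ (extremePoints φ C) = C := by
  refine Finset.Subset.antisymm (φ.closure_min extremePoints_subset hC) ?_
  by_contra h
  obtain ⟨x, hx, hxD⟩ := hφ.exists_mem_extremePoints hC (φ.isClosed_closure _) h
  exact hxD (φ.le_closure _ hx)

/-- In a convex geometry the spanning sets of `C` are the sets between the extreme points of `C`
and `C`. -/
theorem IsConvexGeometry.closure_eq_iff (hφ : IsConvexGeometry φ) (hC : φ.IsClosed C)
    {A : Finset U} : φ A = C ↔ extremePoints φ C ⊆ A ∧ A ⊆ C := by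
  constructor
  · intro h
    exact ⟨extremePoints_subset_of_closure_eq h, h ▸ φ.le_closure A⟩
  · rintro ⟨h1, h2⟩
    refine Finset.Subset.antisymm (φ.closure_min h2 hC) ?_
    calc C = φ (extremePoints φ C) := (hφ.closure_extremePoints hC).symm
      _ ⊆ φ A := φ.monotone h1

/-- The implications that are sound and leave every quasi-closed set form a base: if `X` is not
closed and `φ A` is minimal among the closures of subsets of `X` that are not inside `X`, then
`X ∩ φ A` is a quasi-closed set of `φ A`. -/
theorem isBase_of_forall (hsound : ∀ i ∈ S, i.conclusion ⊆ φ i.premise)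
    (hS : ∀ C Q, IsQuasiClosedOf φ C Q → ∃ i ∈ S, φ i.premise = C ∧ i.premise ⊆ Q ∧
      ¬ i.conclusion ⊆ Q) : IsBase φ S := by
  intro X
  constructor
  · intro hX i hi hp
    exact (hsound i hi).trans (φ.closure_min hp hX)
  · intro hX
    by_contra hcl
    obtain ⟨A, ⟨hAX, hA⟩, hmin⟩ :=
      (Set.toFinite {A : Finset U | A ⊆ X ∧ ¬ φ A ⊆ X}).exists_minimalFor (fun A => φ A) _
      ⟨X, Finset.Subset.refl X, fun h => hcl (φ.isClosed_iff_closure_le.2 h)⟩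
    have hspan : φ (X ∩ φ A) = φ A := by
      refine Finset.Subset.antisymm
        (φ.closure_min Finset.inter_subset_right (φ.isClosed_closure A)) ?_
      exact φ.monotone (Finset.subset_inter hAX (φ.le_closure A))
    have hQ : IsQuasiClosedOf φ (φ A) (X ∩ φ A) := by
      refine ⟨⟨fun h => hA ?_, fun B hB hlt => ?_⟩, hspan⟩
      · rw [← hspan, h.closure_eq]
        exact Finset.inter_subset_left
      · rw [hspan] at hlt
        refine Finset.subset_inter ?_ hlt.subset
        by_contra hBX
        exact hlt.not_subset (hmin ⟨hB.trans Finset.inter_subset_left, hBX⟩ hlt.subset)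
    obtain ⟨i, hi, hiC, hp, hc⟩ := hS _ _ hQ
    exact hc (Finset.subset_inter (hX i hi (hp.trans Finset.inter_subset_left))
      (hiC ▸ hsound i hi))

/-! ### Optimum bases -/

/-- With disjoint edges, an inclusion-minimal transversal is a smallest one: each of its elements
is the only one in some edge, and every transversal meets all these edges. -/
theorem IsTransversal.card_le (hdisj : HasDisjointQCHypergraphs φ)
    (hDC : D ⊆ C) (hD : IsTransversal φ C D)
    (hmin : ∀ x ∈ D, ¬ IsTransversal φ C (D.erase x))
    (hT : IsTransversal φ C T) (hTC : T ⊆ C) : D.card ≤ T.card := by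
  have key : ∀ x ∈ D, ∃ Q, Maximal (IsQuasiClosedOf φ C) Q ∧ D.erase x ⊆ Q ∧ x ∉ Q := by
    intro x hx
    have := hmin x hx
    simp only [IsTransversal, not_forall, not_not] at this
    obtain ⟨Q, hQ, hDQ⟩ := this
    obtain ⟨Q', hle, hQ'⟩ := (Set.toFinite {Q | IsQuasiClosedOf φ C Q}).exists_le_maximal hQ
    refine ⟨Q', hQ', hDQ.trans hle, fun hxQ => hD Q' hQ'.prop fun y hy => ?_⟩
    by_cases e : y = x
    · exact e ▸ hxQ
    · exact hle (hDQ (Finset.mem_erase.2 ⟨e, hy⟩))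
  choose! Q hQ hsub hnot using key
  have hesc : ∀ x ∈ D, ∃ y ∈ T, y ∉ Q x := fun x hx =>
    Finset.not_subset.1 (hT _ (hQ x hx).prop)
  choose! y hyT hyQ using hesc
  refine Finset.card_le_card_of_injOn y hyT fun x hx x' hx' e => ?_
  by_contra hne
  have hEne : (C : Set U) \ Q x ≠ (C : Set U) \ Q x' := by
    intro h
    have : x ∈ (C : Set U) \ Q x' := h ▸ ⟨hDC hx, hnot x hx⟩
    exact this.2 (hsub x' hx' (Finset.mem_erase.2 ⟨hne, hx⟩))
  have hess : IsEssential φ C := ⟨_, (hQ x hx).prop⟩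
  have hd := hdisj C hess (show _ ∈ (qcHypergraph φ C).edgeSet from ⟨Q x, hQ x hx, rfl⟩)
    (show _ ∈ (qcHypergraph φ C).edgeSet from ⟨Q x', hQ x' hx', rfl⟩) hEne
  exact Set.disjoint_left.1 hd (show y x ∈ _ from ⟨hTC (hyT x hx), hyQ x hx⟩)
    ⟨hTC (hyT x hx), e ▸ hyQ x' hx'⟩

/-- A criterion for optimality: one implication for each essential closed set, from its extreme
points to an inclusion-minimal transversal. Any base spends at least as much on the implications
whose premise spans a given essential set. -/
theorem isOptimumBase_of_forall (hdisj : HasDisjointQCHypergraphs φ) (hS : IsBase φ S)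
    (hprem : ∀ i ∈ S, i.premise = extremePoints φ (φ i.premise))
    (hinj : Set.InjOn (fun i : Implication U => φ i.premise) S)
    (hess : ∀ i ∈ S, IsEssential φ (φ i.premise))
    (hmin : ∀ i ∈ S, ∀ x ∈ i.conclusion,
      ¬ IsTransversal φ (φ i.premise) (i.conclusion.erase x))
    (htrans : ∀ i ∈ S, IsTransversal φ (φ i.premise) i.conclusion) : IsOptimumBase φ S := by
  refine ⟨hS, fun S' hS' => ?_⟩
  let F : Finset U → Finset (Implication U) := fun C => S'.filter fun j => φ j.premise = C
  have hle : ∀ i ∈ S, i.premise.card + i.conclusion.card ≤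
      ∑ j ∈ F (φ i.premise), (j.premise.card + j.conclusion.card) := by
    intro i hi
    rw [Finset.sum_add_distrib]
    apply Nat.add_le_add
    · obtain ⟨Q, hQ⟩ := hess i hi
      obtain ⟨j, hj, hjC, -⟩ := hS'.exists_mem hQ
      calc i.premise.card ≤ j.premise.card := by
            apply Finset.card_le_card
            rw [hprem i hi]
            exact extremePoints_subset_of_closure_eq hjC
        _ ≤ _ := Finset.single_le_sum (f := fun j : Implication U => j.premise.card)
            (fun _ _ => Nat.zero_le _) (Finset.mem_filter.2 ⟨hj, hjC⟩)
    · refine le_trans ?_ (Finset.card_biUnion_le (s := F (φ i.premise))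
        (t := fun j : Implication U => j.conclusion))
      refine IsTransversal.card_le hdisj (hS.conclusion_subset hi) (htrans i hi) (hmin i hi) ?_ ?_
      · intro Q hQ hsub
        obtain ⟨j, hj, hjC, -, hjQ⟩ := hS'.exists_mem hQ
        exact hjQ ((Finset.subset_biUnion_of_mem (fun j : Implication U => j.conclusion)
          (Finset.mem_filter.2 ⟨hj, hjC⟩)).trans hsub)
      · rw [Finset.biUnion_subset]
        intro j hj
        obtain ⟨hj, hjC⟩ := Finset.mem_filter.1 hj
        exact hjC ▸ hS'.conclusion_subset hj
  calc totalSize S ≤ ∑ i ∈ S, ∑ j ∈ F (φ i.premise), (j.premise.card + j.conclusion.card) :=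
        Finset.sum_le_sum hle
    _ = ∑ j ∈ S.biUnion fun i => F (φ i.premise), (j.premise.card + j.conclusion.card) := by
        rw [Finset.sum_biUnion]
        intro i hi i' hi' hne
        refine Finset.disjoint_left.2 fun j hj hj' => hne (hinj hi hi' ?_)
        exact (Finset.mem_filter.1 hj).2.symm.trans (Finset.mem_filter.1 hj').2
    _ ≤ totalSize S' := Finset.sum_le_sum_of_subset
        (Finset.biUnion_subset.2 fun i _ => Finset.filter_subset _ _)

/-- The essential sets, each with the implication from its extreme points to the whole set, give a
base, so a minimum base has exactly one implication per essential set. -/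
theorem IsMinimumBase.injOn_and_essential (hφ : IsConvexGeometry φ) (hS : IsMinimumBase φ S) :
    Set.InjOn (fun i : Implication U => φ i.premise) S ∧
      ∀ i ∈ S, IsEssential φ (φ i.premise) := by
  classical
  let ess : Finset (Finset U) := Finset.univ.filter (IsEssential φ)
  have hbase : IsBase φ (ess.image fun C => (⟨extremePoints φ C, C⟩ : Implication U)) := by
    apply isBase_of_forall
    · intro i hi
      obtain ⟨C, hC, rfl⟩ := Finset.mem_image.1 hi
      obtain ⟨Q, hQ⟩ := (Finset.mem_filter.1 hC).2
      exact (hφ.closure_extremePoints hQ.isClosed).symm.subset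
    · intro C Q hQ
      exact ⟨_, Finset.mem_image_of_mem _ (Finset.mem_filter.2 ⟨Finset.mem_univ C, Q, hQ⟩),
        hφ.closure_extremePoints hQ.isClosed, extremePoints_subset_of_closure_eq hQ.2,
        isTransversal_self Q hQ⟩
  have hcard : S.card ≤ ess.card := (hS.2 _ hbase).trans Finset.card_image_le
  have hsub : ess ⊆ S.image fun i => φ i.premise := by
    intro C hC
    obtain ⟨Q, hQ⟩ := (Finset.mem_filter.1 hC).2
    obtain ⟨i, hi, hiC, -⟩ := hS.1.exists_mem hQ
    exact Finset.mem_image.2 ⟨i, hi, hiC⟩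
  have himage : ess = S.image fun i => φ i.premise :=
    Finset.eq_of_subset_of_card_le hsub (Finset.card_image_le.trans hcard)
  refine ⟨Finset.card_image_iff.1 (le_antisymm Finset.card_image_le ?_), fun i hi => ?_⟩
  · rw [← himage]
    exact hcard
  · have : φ i.premise ∈ ess := himage ▸ Finset.mem_image_of_mem _ hi
    exact (Finset.mem_filter.1 this).2

/-- In a convex geometry with disjoint quasi-closed hypergraphs a minimum base with reduced
premises and conclusions meets the criterion `isOptimumBase_of_forall`. -/
theorem IsMinimumBase.isOptimumBase (hφ : IsConvexGeometry φ) (hdisj : HasDisjointQCHypergraphs φ)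
    (hS : IsMinimumBase φ S) (hl : IsLeftReduced φ S) (hr : IsRightReduced φ S) :
    IsOptimumBase φ S := by
  obtain ⟨hinj, hess⟩ := hS.injOn_and_essential hφ
  have hbase := hS.1
  have hprem : ∀ i ∈ S, i.premise = extremePoints φ (φ i.premise) := by
    intro i hi
    by_contra hne
    have hsub : extremePoints φ (φ i.premise) ⊆ i.premise :=
      extremePoints_subset_of_closure_eq rfl
    refine hl i hi _ (hsub.ssubset_of_ne (Ne.symm hne)) fun X => ?_
    rw [hbase X]
    constructor
    · intro h j hj hjX
      rcases Finset.mem_insert.1 hj with rfl | hj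
      · refine h i hi ((φ.le_closure _).trans ?_)
        rw [← hφ.closure_extremePoints (φ.isClosed_closure i.premise)]
        exact φ.closure_min hjX ((hbase X).2 h)
      · exact h j (Finset.mem_of_mem_erase hj) hjX
    · intro h j hj hjX
      by_cases e : j = i
      · subst e
        exact h ⟨extremePoints φ (φ j.premise), j.conclusion⟩ (Finset.mem_insert_self _ _)
          (hsub.trans hjX)
      · exact h j (Finset.mem_insert_of_mem (Finset.mem_erase.2 ⟨e, hj⟩)) hjX
  refine isOptimumBase_of_forall hdisj hbase hprem hinj hess ?_ ?_
  · intro i hi x hx htr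
    refine hr i hi _ (Finset.erase_ssubset hx) (isBase_of_forall ?_ ?_)
    · intro j hj
      rcases Finset.mem_insert.1 hj with rfl | hj
      · exact (Finset.erase_subset _ _).trans (hbase.conclusion_subset hi)
      · exact hbase.conclusion_subset (Finset.mem_of_mem_erase hj)
    · intro C Q hQ
      obtain ⟨j, hj, rfl, hjp, hjc⟩ := hbase.exists_mem hQ
      by_cases e : j = i
      · subst e
        exact ⟨_, Finset.mem_insert_self _ _, rfl, hjp, htr Q hQ⟩
      · exact ⟨j, Finset.mem_insert_of_mem (Finset.mem_erase.2 ⟨e, hj⟩), rfl, hjp, hjc⟩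
  · intro i hi Q hQ
    obtain ⟨j, hj, hjC, -, hjc⟩ := hbase.exists_mem hQ
    exact hinj hj hi hjC ▸ hjc

end ClosureSystem

end ImplicationalBase

namespace ImplicationalBase

section Saturation

/-! ### Saturation under implications -/

variable {U : Type*} [DecidableEq U]

/-- Fire the implication `i` on `R`. If `guarded` is set, only implications whose premise does not
contain `E` may fire: for the extreme points `E` of `C` and inside `C`, these are the implications
whose premise spans a proper subset of `C`. -/
def fire (guarded : Bool) (E R : Finset U) (i : Implication U) : Finset U :=
  if i.premise ⊆ R ∧ (guarded = true → ¬ E ⊆ i.premise) then R ∪ i.conclusion else R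

/-- Fire the implications of `L` in their order and then in the reverse order, in which a machine
finds them after moving the list from one stack to another. -/
def firePass (guarded : Bool) (E : Finset U) (L : List (Implication U)) (R : Finset U) : Finset U :=
  L.reverse.foldl (fire guarded E) (L.foldl (fire guarded E) R)

/-- Fire implications `k` times in a row, which saturates `R` if `k` is the number of points. -/
def saturate (k : ℕ) (guarded : Bool) (E : Finset U) (L : List (Implication U)) (R : Finset U) :
    Finset U :=
  (firePass guarded E L)^[k] R

variable {g : Bool} {E R X : Finset U} {L : List (Implication U)} {i : Implication U} {k : ℕ}

theorem subset_fire : R ⊆ fire g E R i := by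
  unfold fire
  split_ifs
  · exact Finset.subset_union_left
  · exact Finset.Subset.refl R

theorem fire_subset (hR : R ⊆ X)
    (hX : (g = true → ¬ E ⊆ i.premise) → i.premise ⊆ X → i.conclusion ⊆ X) :
    fire g E R i ⊆ X := by
  unfold fire
  split_ifs with h
  · exact Finset.union_subset hR (hX h.2 (h.1.trans hR))
  · exact hR

theorem subset_foldl_fire : R ⊆ L.foldl (fire g E) R := by
  induction L generalizing R with
  | nil => exact Finset.Subset.refl R
  | cons i L ih => exact subset_fire.trans ih

theorem foldl_fire_subset (hR : R ⊆ X)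
    (hX : ∀ i ∈ L, (g = true → ¬ E ⊆ i.premise) → i.premise ⊆ X → i.conclusion ⊆ X) :
    L.foldl (fire g E) R ⊆ X := by
  induction L generalizing R with
  | nil => exact hR
  | cons i L ih =>
    exact ih (fire_subset hR (hX i (List.mem_cons_self))) fun j hj =>
      hX j (List.mem_cons_of_mem _ hj)

theorem conclusion_subset_of_foldl_fire_eq (h : L.foldl (fire g E) R ⊆ R) (hi : i ∈ L)
    (hg : g = true → ¬ E ⊆ i.premise) (hp : i.premise ⊆ R) : i.conclusion ⊆ R := by
  induction L generalizing R with
  | nil => simp at hi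
  | cons j L ih =>
    have hj : fire g E R j = R := Finset.Subset.antisymm (subset_foldl_fire.trans h) subset_fire
    rcases List.mem_cons.1 hi with rfl | hi
    · rw [fire, if_pos ⟨hp, hg⟩] at hj
      exact Finset.union_eq_left.1 hj
    · rw [List.foldl_cons, hj] at h
      exact ih h hi hp

theorem subset_firePass : R ⊆ firePass g E L R := subset_foldl_fire.trans subset_foldl_fire

/-- An extensive map on the subsets of a finite set reaches a fixed point after as many steps as
there are points. -/
theorem iterate_card_fixed [Fintype U] {f : Finset U → Finset U} (hf : ∀ R, R ⊆ f R) :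
    f (f^[Fintype.card U] R) = f^[Fintype.card U] R := by
  have key : ∀ k, f (f^[k] R) = f^[k] R ∨ k ≤ (f^[k] R).card := by
    intro k
    induction k with
    | zero => exact Or.inr (Nat.zero_le _)
    | succ k ih =>
      rw [Function.iterate_succ_apply']
      by_cases h : f (f^[k] R) = f^[k] R
      · left
        rw [h, h]
      · right
        exact Nat.lt_of_le_of_lt (ih.resolve_left h)
          (Finset.card_lt_card ((hf _).ssubset_of_ne (Ne.symm h)))
  rcases key (Fintype.card U) with h | h
  · exact h
  · have : f^[Fintype.card U] R = Finset.univ :=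
      (Finset.card_eq_iff_eq_univ _).1 (le_antisymm (Finset.card_le_univ _) h)
    rw [this]
    exact Finset.univ_subset_iff.1 (hf _)

theorem subset_saturate : R ⊆ saturate k g E L R := by
  unfold saturate
  induction k with
  | zero => exact Finset.Subset.refl R
  | succ k ih =>
    rw [Function.iterate_succ_apply']
    exact ih.trans subset_firePass

theorem saturate_subset (hR : R ⊆ X)
    (hX : ∀ i ∈ L, (g = true → ¬ E ⊆ i.premise) → i.premise ⊆ X → i.conclusion ⊆ X) :
    saturate k g E L R ⊆ X := by
  unfold saturate
  induction k with
  | zero => exact hR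
  | succ k ih =>
    rw [Function.iterate_succ_apply']
    exact foldl_fire_subset (foldl_fire_subset ih hX) fun i hi => hX i (List.mem_reverse.1 hi)

theorem conclusion_subset_saturate [Fintype U] (hi : i ∈ L) (hg : g = true → ¬ E ⊆ i.premise)
    (hp : i.premise ⊆ saturate (Fintype.card U) g E L R) :
    i.conclusion ⊆ saturate (Fintype.card U) g E L R := by
  refine conclusion_subset_of_foldl_fire_eq ?_ hi hg hp
  have h := iterate_card_fixed (R := R)
    fun R => subset_firePass (g := g) (E := E) (L := L) (R := R)
  calc L.foldl (fire g E) (saturate (Fintype.card U) g E L R)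
      ⊆ firePass g E L (saturate (Fintype.card U) g E L R) := subset_foldl_fire
    _ = saturate (Fintype.card U) g E L R := h

end Saturation

section Algorithm

/-! ### The optimization algorithm -/

variable {n : ℕ}

/-- Put `x` into `E` if `x` is an extreme point of `C`. -/
def extremeStep (L : List (Implication (Fin n))) (C E : Finset (Fin n)) (x : Fin n) :
    Finset (Fin n) :=
  if x ∈ C ∧ x ∉ saturate n false E L (E ∪ C.erase x) then insert x E else E

/-- The extreme points of `C`. -/
def extremes (L : List (Implication (Fin n))) (C : Finset (Fin n)) : Finset (Fin n) :=
  (List.finRange n).foldl (extremeStep L C) ∅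

/-- Remove `x` from `T` if this leaves a transversal. -/
def shrinkStep (L : List (Implication (Fin n))) (E T : Finset (Fin n)) (x : Fin n) :
    Finset (Fin n) :=
  if x ∈ saturate n true E L (E ∪ T.erase x) then T.erase x else T

/-- An inclusion-minimal transversal of the quasi-closed hypergraph of `C`. -/
def shrink (L : List (Implication (Fin n))) (C E : Finset (Fin n)) : Finset (Fin n) :=
  (List.finRange n).foldl (shrinkStep L E) C

/-- The closure of `A`. -/
def closureOf (L : List (Implication (Fin n))) (A : Finset (Fin n)) : Finset (Fin n) :=
  saturate n false ∅ L A

/-- The implication that an optimum base has for the closed set `C`; its conclusion is empty if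
`C` is not essential. -/
def optimalImplication (L : List (Implication (Fin n))) (C : Finset (Fin n)) :
    Implication (Fin n) :=
  ⟨extremes L C, shrink L C (extremes L C)⟩

/-- Add the optimal implication for the closure of the premise of `i`, if there is one and it is
new. -/
def addImplication (L acc : List (Implication (Fin n))) (i : Implication (Fin n)) :
    List (Implication (Fin n)) :=
  if (optimalImplication L (closureOf L i.premise)).conclusion = ∅ ∨
      optimalImplication L (closureOf L i.premise) ∈ acc then acc
  else optimalImplication L (closureOf L i.premise) :: acc

/-- The optimization algorithm. The reversals reflect that lists are built from their last element
when they are pushed onto a stack. -/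
def optimize (L : List (Implication (Fin n))) : List (Implication (Fin n)) :=
  (L.reverse.foldl (addImplication L.reverse) []).reverse

variable {φ : ClosureOperator (Finset (Fin n))} {L : List (Implication (Fin n))}
  {C E T : Finset (Fin n)}

theorem closure_eq_saturate (hL : IsBase φ L.toFinset) (A : Finset (Fin n)) :
    saturate n false E L A = φ A := by
  refine Finset.Subset.antisymm (saturate_subset (φ.le_closure A) fun i hi _ hp => ?_)
    (φ.closure_min subset_saturate ((hL _).2 fun i hi hp => ?_))
  · exact (hL _).1 (φ.isClosed_closure A) i (List.mem_toFinset.2 hi) hp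
  · have := conclusion_subset_saturate (U := Fin n) (g := false) (E := E) (R := A)
      (List.mem_toFinset.1 hi) (by simp) (by simpa using hp)
    simpa using this

theorem extremes_eq (hL : IsBase φ L.toFinset) (hC : φ.IsClosed C) :
    extremes L C = extremePoints φ C := by
  have hstep : ∀ E x, E ⊆ extremePoints φ C →
      extremeStep L C E x = if x ∈ extremePoints φ C then insert x E else E := by
    intro E x hE
    unfold extremeStep
    rw [closure_eq_saturate hL]
    by_cases hxE : x ∈ E
    · simp only [hE hxE, Finset.insert_eq_of_mem hxE, ite_self]
    · have hun : E ∪ C.erase x = C.erase x := Finset.union_eq_right.2 fun y hy =>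
        Finset.mem_erase.2 ⟨fun e => hxE (e ▸ hy), extremePoints_subset (hE hy)⟩
      rw [hun]
      congr 1
      rw [mem_extremePoints, eq_iff_iff]
      refine and_congr_right fun hxC => ⟨fun h => ?_, fun h => ?_⟩
      · rw [φ.isClosed_iff_closure_le]
        intro y hy
        exact Finset.mem_erase.2 ⟨fun e => h (e ▸ hy),
          φ.closure_min (Finset.erase_subset x C) hC hy⟩
      · rw [h.closure_eq]
        exact Finset.notMem_erase x C
  have hfold : ∀ (l : List (Fin n)) E, E ⊆ extremePoints φ C →
      l.foldl (extremeStep L C) E = E ∪ extremePoints φ C ∩ l.toFinset := by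
    intro l
    induction l with
    | nil => simp
    | cons x l ih =>
      intro E hE
      rw [List.foldl_cons, hstep E x hE, ih]
      · ext y
        split_ifs with hx <;> simp only [Finset.mem_union, Finset.mem_insert, Finset.mem_inter,
          List.toFinset_cons]
        · grind
        · grind
      · split_ifs with hx
        · exact Finset.insert_subset hx hE
        · exact hE
  have huniv : (List.finRange n).toFinset = Finset.univ := by ext; simp
  rw [extremes, hfold _ _ (Finset.empty_subset _), huniv]
  simp

/-- The saturation of `T` together with the extreme points of `C`, under the implications whose
premise spans less than `C`, is the smallest candidate for a quasi-closed set of `C` above `T`. -/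
theorem saturate_subset_of_isQuasiClosedOf (hL : IsBase φ L.toFinset)
    {Q : Finset (Fin n)} (hQ : IsQuasiClosedOf φ C Q) (hT : T ⊆ Q) :
    saturate n true (extremePoints φ C) L (extremePoints φ C ∪ T) ⊆ Q := by
  refine saturate_subset (Finset.union_subset (extremePoints_subset_of_closure_eq hQ.2) hT) ?_
  intro i hi hg hp
  refine (hL.conclusion_subset (List.mem_toFinset.2 hi)).trans (hQ.1.2 _ hp ?_)
  refine lt_of_le_of_ne (φ.monotone hp) fun e => hg rfl ?_
  exact extremePoints_subset_of_closure_eq (e.trans hQ.2)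

/-- If it is not all of `C`, then that candidate is quasi-closed. -/
theorem isQuasiClosedOf_saturate (hφ : IsConvexGeometry φ) (hL : IsBase φ L.toFinset)
    (hC : φ.IsClosed C) (hT : T ⊆ C)
    (hne : saturate n true (extremePoints φ C) L (extremePoints φ C ∪ T) ≠ C) :
    IsQuasiClosedOf φ C (saturate n true (extremePoints φ C) L (extremePoints φ C ∪ T)) := by
  set R := saturate n true (extremePoints φ C) L (extremePoints φ C ∪ T) with hR
  have hRC : R ⊆ C := saturate_subset (Finset.union_subset extremePoints_subset hT)
    fun i hi _ hp => (hL C).1 hC i (List.mem_toFinset.2 hi) hp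
  have hER : extremePoints φ C ⊆ R := Finset.subset_union_left.trans subset_saturate
  have hspan : φ R = C := (hφ.closure_eq_iff hC).2 ⟨hER, hRC⟩
  refine ⟨⟨fun h => hne (h.closure_eq.symm.trans hspan), fun A hA hlt => ?_⟩, hspan⟩
  rw [hspan] at hlt
  have hcl : φ.IsClosed (R ∩ φ A) := by
    refine (hL _).2 fun i hi hp => ?_
    have hpA : φ i.premise ⊆ φ A :=
      φ.closure_min (hp.trans Finset.inter_subset_right) (φ.isClosed_closure A)
    refine Finset.subset_inter ?_ ((hL.conclusion_subset hi).trans hpA)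
    have := conclusion_subset_saturate (U := Fin n) (g := true) (E := extremePoints φ C)
      (R := extremePoints φ C ∪ T) (List.mem_toFinset.1 hi) (fun _ hE => hlt.not_subset ?_)
      (by simpa [← hR] using hp.trans Finset.inter_subset_left)
    · simpa [← hR] using this
    · calc C = φ (extremePoints φ C) := (hφ.closure_extremePoints hC).symm
        _ ⊆ φ i.premise := φ.monotone hE
        _ ⊆ φ A := hpA
  exact (φ.closure_min (Finset.subset_inter hA (φ.le_closure A)) hcl).trans
    Finset.inter_subset_left

/-- The greedy algorithm keeps `T` a transversal and removes every redundant point. -/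
theorem shrink_spec (hφ : IsConvexGeometry φ) (hL : IsBase φ L.toFinset) (hC : φ.IsClosed C) :
    shrink L C (extremePoints φ C) ⊆ C ∧ IsTransversal φ C (shrink L C (extremePoints φ C)) ∧
      ∀ x ∈ shrink L C (extremePoints φ C),
        ¬ IsTransversal φ C ((shrink L C (extremePoints φ C)).erase x) := by
  have hfold : ∀ (l : List (Fin n)) T, T ⊆ C → IsTransversal φ C T →
      l.foldl (shrinkStep L (extremePoints φ C)) T ⊆ T ∧
      IsTransversal φ C (l.foldl (shrinkStep L (extremePoints φ C)) T) ∧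
      ∀ x ∈ l, x ∈ l.foldl (shrinkStep L (extremePoints φ C)) T →
        ¬ IsTransversal φ C ((l.foldl (shrinkStep L (extremePoints φ C)) T).erase x) := by
    intro l
    induction l with
    | nil => intro T _ hT; exact ⟨Finset.Subset.refl T, hT, by simp⟩
    | cons x l ih =>
      intro T hTC hT
      have hsub : shrinkStep L (extremePoints φ C) T x ⊆ T := by
        unfold shrinkStep
        split_ifs
        · exact Finset.erase_subset x T
        · exact Finset.Subset.refl T
      have htr : IsTransversal φ C (shrinkStep L (extremePoints φ C) T x) := by
        unfold shrinkStep
        split_ifs with h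
        · intro Q hQ hTQ
          refine hT Q hQ fun y hy => ?_
          by_cases e : y = x
          · exact e ▸ saturate_subset_of_isQuasiClosedOf hL hQ hTQ h
          · exact hTQ (Finset.mem_erase.2 ⟨e, hy⟩)
        · exact hT
      obtain ⟨h1, h2, h3⟩ := ih _ (hsub.trans hTC) htr
      refine ⟨h1.trans hsub, h2, fun y hy hyl => ?_⟩
      rcases List.mem_cons.1 hy with rfl | hy
      · intro hcontra
        -- If the final set without `y` is a transversal, then so is the larger set `T` without `y`,
        -- and `y` was removed when its turn came.
        have hTy : IsTransversal φ C (T.erase y) :=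
          hcontra.mono (Finset.erase_subset_erase y (h1.trans hsub))
        have hmem := h1 hyl
        unfold shrinkStep at hmem
        split_ifs at hmem with h
        · exact Finset.notMem_erase y T hmem
        · refine hTy _ (isQuasiClosedOf_saturate hφ hL hC ((Finset.erase_subset y T).trans hTC)
            fun e => h (e.symm.subset (hTC hmem))) (Finset.subset_union_right.trans subset_saturate)
      · exact h3 y hy hyl
  obtain ⟨h1, h2, h3⟩ := hfold (List.finRange n) C (Finset.Subset.refl C) isTransversal_self
  exact ⟨h1, h2, fun x hx => h3 x (List.mem_finRange x) hx⟩

theorem mem_foldl_addImplication {l acc : List (Implication (Fin n))} {j : Implication (Fin n)} :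
    j ∈ l.foldl (addImplication L) acc ↔ j ∈ acc ∨ j.conclusion ≠ ∅ ∧
      ∃ i ∈ l, j = optimalImplication L (closureOf L i.premise) := by
  induction l generalizing acc with
  | nil => simp
  | cons i l ih =>
    rw [List.foldl_cons, ih, addImplication]
    split_ifs with h <;> grind

theorem nodup_foldl_addImplication {l acc : List (Implication (Fin n))} (h : acc.Nodup) :
    (l.foldl (addImplication L) acc).Nodup := by
  induction l generalizing acc with
  | nil => exact h
  | cons i l ih =>
    refine ih ?_
    unfold addImplication
    split_ifs with h'
    · exact h
    · exact List.nodup_cons.2 ⟨fun hm => h' (Or.inr hm), h⟩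

theorem nodup_optimize : (optimize L).Nodup :=
  List.nodup_reverse.2 (nodup_foldl_addImplication List.nodup_nil)

/-- Correctness of the optimization algorithm. -/
theorem isOptimumBase_optimize (hφ : IsConvexGeometry φ) (hdisj : HasDisjointQCHypergraphs φ)
    (hL : IsBase φ L.toFinset) : IsOptimumBase φ (optimize L).toFinset := by
  have hL' : IsBase φ L.reverse.toFinset := by rwa [List.toFinset_reverse]
  have hopt : ∀ A, optimalImplication L.reverse (closureOf L.reverse A) =
      ⟨extremePoints φ (φ A), shrink L.reverse (φ A) (extremePoints φ (φ A))⟩ := by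
    intro A
    rw [closureOf, closure_eq_saturate hL', optimalImplication,
      extremes_eq hL' (φ.isClosed_closure A)]
  have hmem : ∀ j, j ∈ (optimize L).toFinset ↔ j.conclusion ≠ ∅ ∧ ∃ i ∈ L, j =
      ⟨extremePoints φ (φ i.premise),
        shrink L.reverse (φ i.premise) (extremePoints φ (φ i.premise))⟩ := by
    intro j
    rw [List.mem_toFinset, optimize, List.mem_reverse, mem_foldl_addImplication]
    simp only [List.not_mem_nil, false_or, List.mem_reverse, hopt]
  have hspan : ∀ A, φ (extremePoints φ (φ A)) = φ A := fun A =>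
    hφ.closure_extremePoints (φ.isClosed_closure A)
  have hspec := fun A => shrink_spec hφ hL' (φ.isClosed_closure A)
  apply isOptimumBase_of_forall hdisj
  · apply isBase_of_forall
    · intro j hj
      obtain ⟨-, i, -, rfl⟩ := (hmem j).1 hj
      exact (hspec _).1.trans (hspan _).symm.subset
    · intro C Q hQ
      obtain ⟨i, hi, rfl, -⟩ := hL.exists_mem hQ
      refine ⟨_, (hmem _).2 ⟨fun h => ?_, i, List.mem_toFinset.1 hi, rfl⟩, hspan _,
        extremePoints_subset_of_closure_eq hQ.2, (hspec _).2.1 Q hQ⟩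
      exact (hspec i.premise).2.1 Q hQ (h.subset.trans (Finset.empty_subset Q))
  · intro j hj
    obtain ⟨-, i, -, rfl⟩ := (hmem j).1 hj
    rw [hspan]
  · intro j hj j' hj' h
    obtain ⟨-, i, -, rfl⟩ := (hmem j).1 hj
    obtain ⟨-, i', -, rfl⟩ := (hmem j').1 hj'
    simp only [hspan] at h
    rw [h]
  · intro j hj
    obtain ⟨hne, i, -, rfl⟩ := (hmem j).1 hj
    obtain ⟨x, hx⟩ := Finset.nonempty_iff_ne_empty.2 hne
    have := (hspec i.premise).2.2 x hx
    simp only [IsTransversal, not_forall, not_not] at this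
    obtain ⟨Q, hQ, -⟩ := this
    rw [hspan]
    exact ⟨Q, hQ⟩
  · intro j hj
    obtain ⟨-, i, -, rfl⟩ := (hmem j).1 hj
    rw [hspan]
    exact (hspec _).2.2
  · intro j hj
    obtain ⟨-, i, -, rfl⟩ := (hmem j).1 hj
    rw [hspan]
    exact (hspec _).2.1

end Algorithm

end ImplicationalBase

namespace StackProgram

open Turing

section Language

/-! ### Stack programs and their compilation -/

variable {K : Type} {Γ : K → Type} {σ : Type}

/-- An elementary stack operation; the register file has type `σ`, stack `k` has alphabet `Γ k`. -/
inductive Op (Γ : K → Type) (σ : Type) : Type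
  | push (k : K) (f : σ → Γ k)
  | peek (k : K) (f : σ → Option (Γ k) → σ)
  | pop (k : K) (f : σ → Option (Γ k) → σ)
  | load (f : σ → σ)

/-- Programs. `loop pre p body` runs `pre`, stops if `p` fails for the registers, and otherwise
runs `body` and starts again. -/
inductive Cmd (Γ : K → Type) (σ : Type) : Type
  | block (ops : List (Op Γ σ))
  | seq (c d : Cmd Γ σ)
  | ite (p : σ → Bool) (c d : Cmd Γ σ)
  | loop (pre : Cmd Γ σ) (p : σ → Bool) (body : Cmd Γ σ)

/-- The memory of a program: registers and stacks. -/
abbrev Memory (Γ : K → Type) (σ : Type) : Type := σ × ((k : K) → List (Γ k))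

/-- The effect of an operation. -/
def Op.run [DecidableEq K] : Op Γ σ → Memory Γ σ → Memory Γ σ
  | push k f, s => (s.1, Function.update s.2 k (f s.1 :: s.2 k))
  | peek k f, s => (f s.1 (s.2 k).head?, s.2)
  | pop k f, s => (f s.1 (s.2 k).head?, Function.update s.2 k (s.2 k).tail)
  | load f, s => (f s.1, s.2)

/-- `Exec c s s' t`: the program `c`, started in `s`, stops in `s'` after exactly `t` steps of the
compiled machine. -/
inductive Exec [DecidableEq K] : Cmd Γ σ → Memory Γ σ → Memory Γ σ → ℕ → Prop
  | block (ops : List (Op Γ σ)) (s : Memory Γ σ) :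
      Exec (.block ops) s (ops.foldl (fun s o => o.run s) s) 1
  | seq {c d s s₁ s₂ t₁ t₂} (hc : Exec c s s₁ t₁) (hd : Exec d s₁ s₂ t₂) :
      Exec (.seq c d) s s₂ (t₁ + t₂)
  | ite_true {p c d s s₁ t} (hp : p s.1 = true) (hc : Exec c s s₁ t) :
      Exec (.ite p c d) s s₁ (1 + t)
  | ite_false {p c d s s₁ t} (hp : p s.1 = false) (hd : Exec d s s₁ t) :
      Exec (.ite p c d) s s₁ (1 + t)
  | loop_exit {pre p body s s₁ t} (h : Exec pre s s₁ t) (hp : p s₁.1 = false) :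
      Exec (.loop pre p body) s s₁ (t + 1)
  | loop_step {pre p body s s₁ s₂ s₃ t t₁ t₂} (h : Exec pre s s₁ t) (hp : p s₁.1 = true)
      (hb : Exec body s₁ s₂ t₁) (hl : Exec (.loop pre p body) s₂ s₃ t₂) :
      Exec (.loop pre p body) s s₃ (t + 1 + t₁ + t₂)

/-- The code positions of a program. -/
def Cmd.Label : Cmd Γ σ → Type
  | block _ => Unit
  | seq c d => c.Label ⊕ d.Label
  | ite _ c d => Option (c.Label ⊕ d.Label)
  | loop c _ d => Option (c.Label ⊕ d.Label)

/-- There are finitely many code positions. -/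
abbrev Cmd.fintypeLabel : (c : Cmd Γ σ) → Fintype c.Label
  | block _ => inferInstanceAs (Fintype Unit)
  | seq c d =>
    letI := c.fintypeLabel
    letI := d.fintypeLabel
    inferInstanceAs (Fintype (c.Label ⊕ d.Label))
  | ite _ c d =>
    letI := c.fintypeLabel
    letI := d.fintypeLabel
    inferInstanceAs (Fintype (Option (c.Label ⊕ d.Label)))
  | loop c _ d =>
    letI := c.fintypeLabel
    letI := d.fintypeLabel
    inferInstanceAs (Fintype (Option (c.Label ⊕ d.Label)))

/-- The position at which a program starts. -/
def Cmd.entry : (c : Cmd Γ σ) → c.Label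
  | block _ => ()
  | seq c _ => Sum.inl c.entry
  | ite _ _ _ => none
  | loop c _ _ => some (Sum.inl c.entry)

/-- An operation as the beginning of a machine statement. -/
def Op.code {Λ : Type} : Op Γ σ → TM2.Stmt Γ Λ σ → TM2.Stmt Γ Λ σ
  | push k f, q => .push k f q
  | peek k f, q => .peek k f q
  | pop k f, q => .pop k f q
  | load f, q => .load f q

/-- The machine statements of a program whose positions are embedded by `emb` into the labels of
the machine, and which jumps to `ex` when it is done. -/
def Cmd.code {Λ : Type} : (c : Cmd Γ σ) → (emb : c.Label → Λ) → (ex : Λ) → c.Label →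
    TM2.Stmt Γ Λ σ
  | block ops, _, ex, _ => ops.foldr Op.code (.goto fun _ => ex)
  | seq c d, emb, ex, l =>
    match l with
    | Sum.inl l => c.code (fun l => emb (Sum.inl l)) (emb (Sum.inr d.entry)) l
    | Sum.inr l => d.code (fun l => emb (Sum.inr l)) ex l
  | ite p c d, emb, ex, l =>
    match l with
    | none => .branch p (.goto fun _ => emb (some (Sum.inl c.entry)))
        (.goto fun _ => emb (some (Sum.inr d.entry)))
    | some (Sum.inl l) => c.code (fun l => emb (some (Sum.inl l))) ex l
    | some (Sum.inr l) => d.code (fun l => emb (some (Sum.inr l))) ex l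
  | loop c p d, emb, ex, l =>
    match l with
    | none => .branch p (.goto fun _ => emb (some (Sum.inr d.entry))) (.goto fun _ => ex)
    | some (Sum.inl l) => c.code (fun l => emb (some (Sum.inl l))) (emb none) l
    | some (Sum.inr l) => d.code (fun l => emb (some (Sum.inr l)))
        (emb (some (Sum.inl c.entry))) l

variable [DecidableEq K]

/-- The machine `M` gets from `a` to `b` in exactly `t` steps. The formulation is the one of
`StateTransition.EvalsTo`. -/
def Steps {Λ : Type} (M : Λ → TM2.Stmt Γ Λ σ) (a b : TM2.Cfg Γ Λ σ) (t : ℕ) : Prop :=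
  (flip bind (TM2.step M))^[t] (some a) = some b

theorem Steps.trans {Λ : Type} {M : Λ → TM2.Stmt Γ Λ σ} {a b c : TM2.Cfg Γ Λ σ} {t u : ℕ}
    (h : Steps M a b t) (h' : Steps M b c u) : Steps M a c (t + u) := by
  unfold Steps at *
  rw [Nat.add_comm, Function.iterate_add_apply, h, h']

theorem Steps.single {Λ : Type} {M : Λ → TM2.Stmt Γ Λ σ} {a b : TM2.Cfg Γ Λ σ}
    (h : TM2.step M a = some b) : Steps M a b 1 := h

theorem stepAux_foldr_code {Λ : Type} (ops : List (Op Γ σ)) (q : TM2.Stmt Γ Λ σ)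
    (s : Memory Γ σ) :
    TM2.stepAux (ops.foldr Op.code q) s.1 s.2 =
      TM2.stepAux q (ops.foldl (fun s o => o.run s) s).1 (ops.foldl (fun s o => o.run s) s).2 := by
  induction ops generalizing s with
  | nil => rfl
  | cons o ops ih =>
    rw [List.foldr_cons, List.foldl_cons, ← ih]
    cases o <;> rfl

/-- Correctness of the compilation, with exact running time. -/
theorem Exec.steps {Λ : Type} {M : Λ → TM2.Stmt Γ Λ σ} {c : Cmd Γ σ} {s s' : Memory Γ σ} {t : ℕ}
    (h : Exec c s s' t) (emb : c.Label → Λ) (ex : Λ) (hM : ∀ l, M (emb l) = c.code emb ex l) :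
    Steps M ⟨some (emb c.entry), s.1, s.2⟩ ⟨some ex, s'.1, s'.2⟩ t := by
  induction h generalizing ex with
  | block ops s =>
    apply Steps.single
    rw [TM2.step, hM]
    simp only [Cmd.code, stepAux_foldr_code, TM2.stepAux]
  | seq hc hd ihc ihd =>
    exact (ihc (fun l => emb (Sum.inl l)) _ fun l => hM (Sum.inl l)).trans
      (ihd (fun l => emb (Sum.inr l)) _ fun l => hM (Sum.inr l))
  | ite_true hp hc ih =>
    refine Steps.trans (Steps.single ?_)
      (ih (fun l => emb (some (Sum.inl l))) _ fun l => hM (some (Sum.inl l)))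
    simp only [Cmd.entry, TM2.step, show M (emb none) = _ from hM none, Cmd.code, TM2.stepAux, hp,
      cond_true]
  | ite_false hp hc ih =>
    refine Steps.trans (Steps.single ?_)
      (ih (fun l => emb (some (Sum.inr l))) _ fun l => hM (some (Sum.inr l)))
    simp only [Cmd.entry, TM2.step, show M (emb none) = _ from hM none, Cmd.code, TM2.stepAux, hp,
      cond_false]
  | loop_exit h hp ih =>
    refine Steps.trans (ih (fun l => emb (some (Sum.inl l))) _ fun l => hM (some (Sum.inl l)))
      (Steps.single ?_)
    simp only [TM2.step, show M (emb none) = _ from hM none, Cmd.code, TM2.stepAux, hp, cond_false]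
  | loop_step h hp hb hl ih ihb ihl =>
    refine Steps.trans (Steps.trans (Steps.trans
      (ih (fun l => emb (some (Sum.inl l))) _ fun l => hM (some (Sum.inl l)))
      (Steps.single ?_))
      (ihb (fun l => emb (some (Sum.inr l))) _ fun l => hM (some (Sum.inr l))))
      (ihl emb ex hM)
    simp only [TM2.step, show M (emb none) = _ from hM none, Cmd.code, TM2.stepAux, hp, cond_true]

/-- The machine that runs the program `c` and then halts. -/
def Cmd.machine (c : Cmd Γ σ) : Option c.Label → TM2.Stmt Γ (Option c.Label) σ
  | some l => c.code some none l
  | none => .halt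

theorem Exec.steps_machine {c : Cmd Γ σ} {s s' : Memory Γ σ} {t : ℕ} (h : Exec c s s' t) :
    Steps c.machine ⟨some (some c.entry), s.1, s.2⟩ ⟨none, s'.1, s'.2⟩ (t + 1) :=
  (h.steps (M := c.machine) some none fun _ => rfl).trans (Steps.single rfl)

end Language

end StackProgram

namespace StackProgram

/-! ### Registers and stacks -/

open Computability (Γ')

/-- One position of the working word: the membership of a point in the current closed set `C`, in
the set `E` of its extreme points, in the shrinking transversal `T` and in the set `R` that is being
saturated, and the marks that drive the loop over all points (`todo`: still to be handled, `cur`: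
being handled). -/
@[ext]
structure Cell where
  c : Bool
  e : Bool
  t : Bool
  r : Bool
  todo : Bool
  cur : Bool
  deriving DecidableEq, Fintype

/-- The registers: the symbols read last from the various kinds of stacks, and two flags. -/
structure Reg where
  sym : Option (Option (Bool × Bool))
  pair : Option (Bool × Bool)
  cell : Option Cell
  chr : Option Γ'
  tick : Option Unit
  flag : Bool × Bool

noncomputable instance : Fintype Reg :=
  Fintype.ofInjective (fun r => (r.sym, r.pair, r.cell, r.chr, r.tick, r.flag)) fun r r' h => by
    cases r
    cases r'
    simpa using h

/-- The stacks: input, output, lists of implications (`lst i d` is the base for `i = false` and the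
result for `i = true`; `d = true` is the stack to which such a list is moved while it is scanned),
the list of implications that are still to be handled, two stacks for auxiliary words, the working
word and its reversal, and a unary counter with its reversal. -/
inductive Stk
  | inp
  | out
  | lst (i d : Bool)
  | job
  | tmp
  | aux
  | work
  | workR
  | cnt
  | cntR
  deriving DecidableEq, Fintype

/-- The stack alphabets. In lists of implications `none` ends an implication. -/
abbrev Alph : Stk → Type
  | .inp => Γ'
  | .out => Γ'
  | .lst _ _ => Option (Bool × Bool)
  | .job => Option (Bool × Bool)
  | .tmp => Bool × Bool
  | .aux => Bool × Bool
  | .work => Cell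
  | .workR => Cell
  | .cnt => Unit
  | .cntR => Unit

/-- The memory of the program, by name. -/
structure Mem extends Reg where
  inp : List Γ'
  out : List Γ'
  base : List (Option (Bool × Bool))
  baseR : List (Option (Bool × Bool))
  res : List (Option (Bool × Bool))
  resR : List (Option (Bool × Bool))
  job : List (Option (Bool × Bool))
  tmp : List (Bool × Bool)
  aux : List (Bool × Bool)
  work : List Cell
  workR : List Cell
  cnt : List Unit
  cntR : List Unit

/-- The contents of a stack. -/
def Mem.get (m : Mem) : (k : Stk) → List (Alph k)
  | .inp => m.inp
  | .out => m.out
  | .lst false false => m.base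
  | .lst false true => m.baseR
  | .lst true false => m.res
  | .lst true true => m.resR
  | .job => m.job
  | .tmp => m.tmp
  | .aux => m.aux
  | .work => m.work
  | .workR => m.workR
  | .cnt => m.cnt
  | .cntR => m.cntR

/-- Replace the contents of a stack. -/
def Mem.set (m : Mem) : (k : Stk) → List (Alph k) → Mem
  | .inp, l => { m with inp := l }
  | .out, l => { m with out := l }
  | .lst false false, l => { m with base := l }
  | .lst false true, l => { m with baseR := l }
  | .lst true false, l => { m with res := l }
  | .lst true true, l => { m with resR := l }
  | .job, l => { m with job := l }
  | .tmp, l => { m with tmp := l }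
  | .aux, l => { m with aux := l }
  | .work, l => { m with work := l }
  | .workR, l => { m with workR := l }
  | .cnt, l => { m with cnt := l }
  | .cntR, l => { m with cntR := l }

/-- The names describe the stacks faithfully. -/
theorem Mem.get_set (m : Mem) (k : Stk) (l : List (Alph k)) :
    (m.set k l).get = Function.update m.get k l := by
  funext k'
  by_cases h : k' = k
  · subst h
    rw [Function.update_self]
    rcases k' with _ | _ | ⟨_ | _, _ | _⟩ | _ | _ | _ | _ | _ | _ | _ <;> rfl
  · rw [Function.update_of_ne h]
    rcases k with _ | _ | ⟨_ | _, _ | _⟩ | _ | _ | _ | _ | _ | _ | _ <;>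
      rcases k' with _ | _ | ⟨_ | _, _ | _⟩ | _ | _ | _ | _ | _ | _ | _ <;>
      first | rfl | exact absurd rfl h

theorem Mem.toReg_set (m : Mem) (k : Stk) (l : List (Alph k)) : (m.set k l).toReg = m.toReg := by
  rcases k with _ | _ | ⟨_ | _, _ | _⟩ | _ | _ | _ | _ | _ | _ | _ <;> rfl

/-- The memory as registers and stacks. -/
def Mem.memory (m : Mem) : Memory Alph Reg := (m.toReg, m.get)

/-- The effect of an operation on the named memory. -/
def act (m : Mem) : Op Alph Reg → Mem
  | .push k f => m.set k (f m.toReg :: m.get k)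
  | .peek k f => { m with toReg := f m.toReg (m.get k).head? }
  | .pop k f => { m.set k (m.get k).tail with toReg := f m.toReg (m.get k).head? }
  | .load f => { m with toReg := f m.toReg }

theorem memory_act (m : Mem) (o : Op Alph Reg) : (act m o).memory = o.run m.memory := by
  cases o with
  | push k f => exact Prod.ext (m.toReg_set k _) (m.get_set k _)
  | peek k f => rfl
  | pop k f => exact Prod.ext rfl (m.get_set k _)
  | load f => rfl

/-- The program `c`, started in `m`, stops in `m'` after at most `T` steps. -/
def Run (c : Cmd Alph Reg) (m m' : Mem) (T : ℕ) : Prop :=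
  ∃ t ≤ T, Exec c m.memory m'.memory t

theorem memory_foldl_act (ops : List (Op Alph Reg)) (m : Mem) :
    (ops.foldl act m).memory = ops.foldl (fun s o => o.run s) m.memory := by
  induction ops generalizing m with
  | nil => rfl
  | cons o ops ih => rw [List.foldl_cons, List.foldl_cons, ih, memory_act]

theorem Run.block {ops : List (Op Alph Reg)} {m m' : Mem} (h : ops.foldl act m = m') :
    Run (.block ops) m m' 1 := by
  refine ⟨1, le_rfl, ?_⟩
  rw [← h, memory_foldl_act]
  exact .block ops _

theorem Run.mono {c : Cmd Alph Reg} {m m' : Mem} {T T' : ℕ} (h : Run c m m' T) (hT : T ≤ T') :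
    Run c m m' T' := by
  obtain ⟨t, ht, h⟩ := h
  exact ⟨t, ht.trans hT, h⟩

theorem Run.seq {c d : Cmd Alph Reg} {m m₁ m₂ : Mem} {T₁ T₂ : ℕ} (hc : Run c m m₁ T₁)
    (hd : Run d m₁ m₂ T₂) : Run (.seq c d) m m₂ (T₁ + T₂) := by
  obtain ⟨t, ht, h⟩ := hc
  obtain ⟨t', ht', h'⟩ := hd
  exact ⟨t + t', Nat.add_le_add ht ht', .seq h h'⟩

theorem Run.ite {p : Reg → Bool} {c d : Cmd Alph Reg} {m m' : Mem} {T : ℕ}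
    (h : Run (if p m.toReg then c else d) m m' T) : Run (.ite p c d) m m' (1 + T) := by
  obtain ⟨t, ht, h⟩ := h
  refine ⟨1 + t, Nat.add_le_add_left ht 1, ?_⟩
  by_cases hp : p m.toReg = true
  · rw [if_pos hp] at h
    exact .ite_true hp h
  · rw [if_neg hp] at h
    exact .ite_false (Bool.eq_false_iff.2 hp) h

theorem Run.loop_exit {p : Reg → Bool} {pre body : Cmd Alph Reg} {m m' : Mem} {T : ℕ}
    (h : Run pre m m' T) (hp : p m'.toReg = false) : Run (.loop pre p body) m m' (T + 1) := by
  obtain ⟨t, ht, h⟩ := h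
  exact ⟨t + 1, Nat.add_le_add_right ht 1, .loop_exit h hp⟩

theorem Run.loop_step {p : Reg → Bool} {pre body : Cmd Alph Reg} {m m₁ m₂ m₃ : Mem}
    {T T₁ T₂ : ℕ} (h : Run pre m m₁ T) (hp : p m₁.toReg = true) (hb : Run body m₁ m₂ T₁)
    (hl : Run (.loop pre p body) m₂ m₃ T₂) : Run (.loop pre p body) m m₃ (T + 1 + T₁ + T₂) := by
  obtain ⟨t, ht, h⟩ := h
  obtain ⟨t₁, ht₁, h₁⟩ := hb
  obtain ⟨t₂, ht₂, h₂⟩ := hl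
  exact ⟨t + 1 + t₁ + t₂, by omega, .loop_step h hp h₁ h₂⟩

/-- A loop that consumes a list `l` and updates an accumulator: `st b l` is the memory before the
test with accumulator `b` and remaining list `l`. -/
theorem Run.loop_foldl {α β : Type} {pre body : Cmd Alph Reg} {p : Reg → Bool} {T₀ T₁ : ℕ}
    (st : β → List α → Mem) (up : β → α → β) (mid : β → α → List α → Mem) (fin : β → Mem)
    (hpre : ∀ b a l, Run pre (st b (a :: l)) (mid b a l) T₀)
    (hp : ∀ b a l, p (mid b a l).toReg = true)
    (hbody : ∀ b a l, Run body (mid b a l) (st (up b a) l) T₁)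
    (hnil : ∀ b, Run pre (st b []) (fin b) T₀) (hp' : ∀ b, p (fin b).toReg = false)
    (b : β) (l : List α) {m m' : Mem} {T : ℕ} (hm : m = st b l) (hm' : fin (l.foldl up b) = m')
    (hT : l.length * (T₀ + 1 + T₁) + (T₀ + 1) ≤ T) : Run (.loop pre p body) m m' T := by
  subst hm hm'
  refine Run.mono ?_ hT
  clear hT
  induction l generalizing b with
  | nil => exact ((Run.loop_exit (hnil b) (hp' b))).mono (by simp)
  | cons a l ih =>
    refine (Run.loop_step (hpre b a l) (hp b a l) (hbody b a l) (ih (up b a))).mono ?_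
    rw [List.length_cons, Nat.add_mul]
    omega

/-- A loop whose test and body are blocks, in the situation of `Run.loop_foldl`. -/
theorem Run.loop_block {α β : Type} {ops ops' : List (Op Alph Reg)} {p : Reg → Bool}
    (st : β → List α → Mem) (up : β → α → β)
    (hstep : ∀ b a l, ops'.foldl act (ops.foldl act (st b (a :: l))) = st (up b a) l)
    (hp : ∀ b a l, p (ops.foldl act (st b (a :: l))).toReg = true)
    (hp' : ∀ b, p (ops.foldl act (st b [])).toReg = false)
    (b : β) (l : List α) {m m' : Mem} {T : ℕ} (hm : st b l = m)
    (hm' : ops.foldl act (st (l.foldl up b) []) = m') (hT : 3 * l.length + 2 ≤ T) :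
    Run (.loop (.block ops) p (.block ops')) m m' T :=
  Run.loop_foldl st up (fun b a l => ops.foldl act (st b (a :: l)))
    (fun b => ops.foldl act (st b [])) (fun _ _ _ => .block rfl) hp
    (fun b a l => .block (hstep b a l)) (fun _ => .block rfl) hp' b l hm.symm hm' (by omega)

/-! ### Passes over the working word -/

/-- The cell in the register. -/
def Reg.theCell (r : Reg) : Cell := r.cell.getD ⟨false, false, false, false, false, false⟩

/-- The pair in the register. -/
def Reg.thePair (r : Reg) : Bool × Bool := r.pair.getD (false, false)

/-- The symbol of an implication in the register. -/
def Reg.theSym (r : Reg) : Bool × Bool := (r.sym.getD none).getD (false, false)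

/-- The register holds a symbol of an implication, and not its end mark. -/
def Reg.isPair (r : Reg) : Bool := (r.sym.getD none).isSome

/-- Forget the symbols that were read. -/
def Reg.clear (r : Reg) : Reg := ⟨none, none, none, none, none, r.flag⟩

/-- Read a cell of the working word. -/
def popWork : Op Alph Reg := .pop .work fun r o => { r with cell := o }
/-- Read a cell of the reversed working word. -/
def popWorkR : Op Alph Reg := .pop .workR fun r o => { r with cell := o }
/-- Read a pair from the first auxiliary stack. -/
def popTmp : Op Alph Reg := .pop .tmp fun r o => { r with pair := o }
/-- Read a symbol of a list of implications. -/
def popLst (i d : Bool) : Op Alph Reg := .pop (.lst i d) fun r o => { r with sym := o }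

/-- Move the working word, with changes by `h`, to the reversed working word. -/
def passForward (h : Bool × Bool → Cell → (Bool × Bool) × Cell) : Cmd Alph Reg :=
  .loop (.block [popWork]) (fun r => r.cell.isSome) (.block
    [.push .workR fun r => (h r.flag r.theCell).2,
      .load fun r => { r.clear with flag := (h r.flag r.theCell).1 }])

/-- Restore the working word from the reversed working word. -/
def rewind : Cmd Alph Reg :=
  .loop (.block [popWorkR]) (fun r => r.cell.isSome) (.block
    [.push .work Reg.theCell, .load Reg.clear])

/-- Map `h`, which may read and change the flags, over the working word. -/
def pass (h : Bool × Bool → Cell → (Bool × Bool) × Cell) : Cmd Alph Reg :=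
  .seq (passForward h) rewind

/-- The result of a pass over the word `l`. -/
def mapFlag (h : Bool × Bool → Cell → (Bool × Bool) × Cell) (f : Bool × Bool) :
    List Cell → (Bool × Bool) × List Cell
  | [] => (f, [])
  | y :: l => ((mapFlag h (h f y).1 l).1, (h f y).2 :: (mapFlag h (h f y).1 l).2)

theorem length_mapFlag (h : Bool × Bool → Cell → (Bool × Bool) × Cell) (f : Bool × Bool)
    (l : List Cell) : (mapFlag h f l).2.length = l.length := by
  induction l generalizing f with
  | nil => rfl
  | cons y l ih => simp [mapFlag, ih]

theorem foldl_cons_map {α β : Type} (f : α → β) (l : List α) (acc : List β) :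
    l.foldl (fun b a => f a :: b) acc = (l.map f).reverse ++ acc := by
  induction l generalizing acc with
  | nil => rfl
  | cons a l ih => simp [ih]

theorem foldl_mapFlag (h : Bool × Bool → Cell → (Bool × Bool) × Cell) (l : List Cell)
    (f : Bool × Bool) (acc : List Cell) :
    l.foldl (fun (b : (Bool × Bool) × List Cell) y => ((h b.1 y).1, (h b.1 y).2 :: b.2)) (f, acc) =
      ((mapFlag h f l).1, (mapFlag h f l).2.reverse ++ acc) := by
  induction l generalizing f acc with
  | nil => rfl
  | cons y l ih => simp [mapFlag, ih]

theorem run_passForward (h : Bool × Bool → Cell → (Bool × Bool) × Cell) (m : Mem)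
    (hr : m.toReg = m.clear) (hR : m.workR = []) :
    Run (passForward h) m { m with
      flag := (mapFlag h m.flag m.work).1
      work := []
      workR := (mapFlag h m.flag m.work).2.reverse } (3 * m.work.length + 2) := by
  obtain ⟨⟨sym, pair, cell, chr, tick, flag⟩, inp, out, base, baseR, res, resR, job, tmp, aux, work,
    workR, cnt, cntR⟩ := m
  simp only [Reg.clear, Reg.mk.injEq, and_true] at hr hR ⊢
  obtain ⟨rfl, rfl, rfl, rfl, rfl⟩ := hr
  subst hR
  refine Run.loop_block
      (fun (b : (Bool × Bool) × List Cell) l => ⟨⟨none, none, none, none, none, b.1⟩, inp, out,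
        base, baseR, res, resR, job, tmp, aux, l, b.2, cnt, cntR⟩)
      (fun b y => ((h b.1 y).1, (h b.1 y).2 :: b.2))
      (fun _ _ _ => rfl) (fun _ _ _ => rfl) (fun _ => rfl) (flag, []) work rfl ?_ le_rfl
  rw [foldl_mapFlag, List.append_nil]
  rfl

theorem run_rewind (m : Mem) (hr : m.toReg = m.clear) (hw : m.work = []) :
    Run rewind m { m with
      work := m.workR.reverse
      workR := [] } (3 * m.workR.length + 2) := by
  obtain ⟨⟨sym, pair, cell, chr, tick, flag⟩, inp, out, base, baseR, res, resR, job, tmp, aux, work,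
    workR, cnt, cntR⟩ := m
  simp only [Reg.clear, Reg.mk.injEq, and_true] at hr hw ⊢
  obtain ⟨rfl, rfl, rfl, rfl, rfl⟩ := hr
  subst hw
  refine Run.loop_block
      (fun (b : List Cell) l => ⟨⟨none, none, none, none, none, flag⟩, inp, out,
        base, baseR, res, resR, job, tmp, aux, b, l, cnt, cntR⟩)
      (fun b y => y :: b)
      (fun _ _ _ => rfl) (fun _ _ _ => rfl) (fun _ => rfl) [] workR rfl ?_ le_rfl
  rw [foldl_cons_map (fun y => y), List.map_id', List.append_nil]
  rfl

theorem run_pass (h : Bool × Bool → Cell → (Bool × Bool) × Cell) (m : Mem)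
    (hr : m.toReg = m.clear) (hR : m.workR = []) :
    Run (pass h) m { m with
      flag := (mapFlag h m.flag m.work).1
      work := (mapFlag h m.flag m.work).2 } (6 * m.work.length + 4) := by
  obtain ⟨r, inp, out, base, baseR, res, resR, job, tmp, aux, work, workR, cnt, cntR⟩ := m
  obtain rfl : workR = [] := hR
  have h1 := run_passForward h ⟨r, inp, out, base, baseR, res, resR, job, tmp, aux, work, [], cnt,
    cntR⟩ hr rfl
  have h2 := run_rewind ⟨{ r with flag := (mapFlag h r.flag work).1 }, inp, out, base, baseR, res,
    resR, job, tmp, aux, [], (mapFlag h r.flag work).2.reverse, cnt, cntR⟩ (by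
      simp only [Reg.clear] at hr ⊢
      rw [hr]) rfl
  simp only [List.reverse_reverse, List.length_reverse, length_mapFlag] at h2
  exact (h1.seq h2).mono (by dsimp only; omega)

/-! ### Scanning a list of implications -/

/-- What to do for each implication of a list: `init` changes the flags before it, `fw` reads it
together with the working word, `bw` then changes the working word, and `fin` changes the flags
after it. -/
structure Scan where
  init : Bool × Bool → Bool × Bool
  fw : Bool × Bool → Bool × Bool → Cell → Bool × Bool
  bw : Bool × Bool → Bool × Bool → Cell → Cell
  fin : Bool × Bool → Bool × Bool

/-- Read one implication and the working word in parallel. -/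
def scanForward (s : Scan) (i d : Bool) : Cmd Alph Reg :=
  .loop (.block [popLst i d]) Reg.isPair (.block
    [popWork, .push .tmp Reg.theSym, .push .workR Reg.theCell,
      .load fun r => { r.clear with flag := s.fw r.flag r.theSym r.theCell }])

/-- Restore the working word, with changes, and move the implication to the other list. -/
def scanBackward (s : Scan) (i d : Bool) : Cmd Alph Reg :=
  .loop (.block [popWorkR]) (fun r => r.cell.isSome) (.block
    [popTmp, .push .work fun r => s.bw r.flag r.thePair r.theCell,
      .push (.lst i !d) fun r => some r.thePair, .load Reg.clear])

/-- Scan the list of implications `.lst i d` and move it to `.lst i !d`. -/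
def scan (s : Scan) (i d : Bool) : Cmd Alph Reg :=
  .loop (.block [.peek (.lst i d) fun r o => { r with sym := o }]) (fun r => r.sym.isSome)
    (.seq (.block [.load fun r => { r.clear with flag := s.init r.flag }])
      (.seq (scanForward s i d)
        (.seq (.block [.push (.lst i !d) fun _ => none, .load Reg.clear])
          (.seq (scanBackward s i d) (.block [.load fun r => { r with flag := s.fin r.flag }])))))

/-- The memory with cleared registers, flags `f`, contents `A` and `B` of the lists `.lst i d` and
`.lst i !d`, and given auxiliary words. -/
def scanMem (m : Mem) (i d : Bool) (f : Bool × Bool) (A B : List (Option (Bool × Bool)))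
    (tmp : List (Bool × Bool)) (work workR : List Cell) : Mem :=
  match i, d with
  | false, false =>
    { m with toReg := ⟨none, none, none, none, none, f⟩, base := A, baseR := B, tmp, work, workR }
  | false, true =>
    { m with toReg := ⟨none, none, none, none, none, f⟩, baseR := A, base := B, tmp, work, workR }
  | true, false =>
    { m with toReg := ⟨none, none, none, none, none, f⟩, res := A, resR := B, tmp, work, workR }
  | true, true =>
    { m with toReg := ⟨none, none, none, none, none, f⟩, resR := A, res := B, tmp, work, workR }

/-- The flags after reading an implication, given as a word together with the working word. -/
def Scan.flags (s : Scan) (f : Bool × Bool) (z : List ((Bool × Bool) × Cell)) : Bool × Bool :=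
  z.foldl (fun f q => s.fw f q.1 q.2) (s.init f)

/-- An implication, given as a word of pairs, on its stack. -/
def stackWord (z : List (Bool × Bool)) : List (Option (Bool × Bool)) := z.map some ++ [none]

theorem foldl_scanForward (s : Scan) (z : List ((Bool × Bool) × Cell)) (f : Bool × Bool)
    (t : List (Bool × Bool)) (w : List Cell) :
    z.foldl (fun (b : (Bool × Bool) × List (Bool × Bool) × List Cell) q =>
      (s.fw b.1 q.1 q.2, q.1 :: b.2.1, q.2 :: b.2.2)) (f, t, w) =
      (z.foldl (fun f q => s.fw f q.1 q.2) f, (z.map Prod.fst).reverse ++ t,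
        (z.map Prod.snd).reverse ++ w) := by
  induction z generalizing f t w with
  | nil => rfl
  | cons q z ih => simp [ih]

theorem foldl_scanBackward (s : Scan) (z : List ((Bool × Bool) × Cell)) (f : Bool × Bool)
    (B : List (Option (Bool × Bool))) (w : List Cell) :
    z.foldl (fun (b : List (Option (Bool × Bool)) × List Cell) q =>
      (some q.1 :: b.1, s.bw f q.1 q.2 :: b.2)) (B, w) =
      ((z.map fun q => some q.1).reverse ++ B, (z.map fun q => s.bw f q.1 q.2).reverse ++ w) := by
  induction z generalizing B w with
  | nil => rfl
  | cons q z ih => simp [ih]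

/-- The body of `scan`, on an implication that is given together with the working word. -/
theorem run_scan_body (s : Scan) (i d : Bool) (m : Mem) (f : Bool × Bool)
    (A B : List (Option (Bool × Bool))) (z : List ((Bool × Bool) × Cell)) (m' : Mem)
    (hm' : { scanMem m i d f (stackWord (z.map Prod.fst) ++ A) B [] (z.map Prod.snd) [] with
      sym := (stackWord (z.map Prod.fst) ++ A).head? } = m') :
    Run (.seq (.block [.load fun r => { r.clear with flag := s.init r.flag }])
      (.seq (scanForward s i d)
        (.seq (.block [.push (.lst i !d) fun _ => none, .load Reg.clear])
          (.seq (scanBackward s i d) (.block [.load fun r => { r with flag := s.fin r.flag }])))))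
      m'
      (scanMem m i d (s.fin (s.flags f z)) A (stackWord (z.map Prod.fst) ++ B) []
        (z.map fun q => s.bw (s.flags f z) q.1 q.2) []) (6 * z.length + 7) := by
  subst hm'
  refine Run.mono (Run.seq (T₁ := 1) (T₂ := 6 * z.length + 6)
    (m₁ := scanMem m i d (s.init f) (stackWord (z.map Prod.fst) ++ A) B [] (z.map Prod.snd) [])
    (.block (by cases i <;> cases d <;> rfl)) ?_) (by omega)
  refine Run.mono (Run.seq (T₁ := 3 * z.length + 2) (T₂ := 3 * z.length + 4)
    (m₁ := { scanMem m i d (s.flags f z) A B (z.map Prod.fst).reverse []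
        (z.map Prod.snd).reverse with
      sym := some none })
    (Run.loop_block
      (fun (b : (Bool × Bool) × List (Bool × Bool) × List Cell) l =>
        scanMem m i d b.1 (stackWord (l.map Prod.fst) ++ A) B b.2.1 (l.map Prod.snd) b.2.2)
      (fun b q => (s.fw b.1 q.1 q.2, q.1 :: b.2.1, q.2 :: b.2.2))
      (by intros; cases i <;> cases d <;> rfl) (by intros; cases i <;> cases d <;> rfl)
      (by intros; cases i <;> cases d <;> rfl) (s.init f, [], []) z rfl ?_ le_rfl) ?_) (by omega)
  · rw [foldl_scanForward, List.append_nil, List.append_nil]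
    cases i <;> cases d <;> rfl
  refine Run.mono (Run.seq (T₁ := 1) (T₂ := 3 * z.length + 3)
    (m₁ := scanMem m i d (s.flags f z) A (none :: B) (z.map Prod.fst).reverse []
      (z.map Prod.snd).reverse)
    (.block (by cases i <;> cases d <;> rfl)) ?_) (by omega)
  refine Run.mono (Run.seq (T₁ := 3 * z.length + 2) (T₂ := 1)
    (m₁ := scanMem m i d (s.flags f z) A (stackWord (z.map Prod.fst) ++ B) []
      (z.map fun q => s.bw (s.flags f z) q.1 q.2) [])
    (Run.loop_block
      (fun (b : List (Option (Bool × Bool)) × List Cell) (l : List ((Bool × Bool) × Cell)) =>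
        scanMem m i d (s.flags f z) A b.1 (l.map Prod.fst) b.2 (l.map Prod.snd))
      (fun b q => (some q.1 :: b.1, s.bw (s.flags f z) q.1 q.2 :: b.2))
      (by intros; cases i <;> cases d <;> rfl) (by intros; cases i <;> cases d <;> rfl)
      (by intros; cases i <;> cases d <;> rfl) (none :: B, []) z.reverse
      (by rw [List.map_reverse, List.map_reverse]) ?_ (by simp))
    (.block (by cases i <;> cases d <;> rfl))) (by omega)
  · have : stackWord (z.map Prod.fst) ++ B = (z.map fun q => some q.1) ++ none :: B := by
      simp [stackWord]
    rw [foldl_scanBackward, this]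
    simp only [List.map_reverse, List.reverse_reverse, List.append_nil]
    cases i <;> cases d <;> rfl

end StackProgram

namespace StackProgram

/-! ### Implications and sets on the stacks -/

variable {n : ℕ}

/-- A family of symbols indexed by the ground set, as a word. -/
def word {α : Type} (w : Fin n → α) : List α := (List.finRange n).map w

theorem length_word {α : Type} (w : Fin n → α) : (word w).length = n := by simp [word]

/-- The symbols of an implication. -/
def symbols (i : Implication (Fin n)) (x : Fin n) : Bool × Bool :=
  (decide (x ∈ i.premise), decide (x ∈ i.conclusion))

/-- A list of implications on its stack. -/
def stackList (L : List (Implication (Fin n))) : List (Option (Bool × Bool)) :=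
  L.flatMap fun i => stackWord (word (symbols i))

theorem stackList_cons (i : Implication (Fin n)) (L : List (Implication (Fin n))) :
    stackList (i :: L) = stackWord (word (symbols i)) ++ stackList L := rfl

theorem head?_stackList_cons (i : Implication (Fin n)) (L : List (Implication (Fin n))) :
    ((stackList (i :: L)).head?).isSome = true := by
  rw [stackList_cons, stackWord]
  cases word (symbols i) <;> rfl

/-- The effect of a scan step on the flags and the working word. -/
def Scan.step (s : Scan) (b : (Bool × Bool) × (Fin n → Cell)) (i : Implication (Fin n)) :
    (Bool × Bool) × (Fin n → Cell) :=
  let f := s.flags b.1 (word fun x => (symbols i x, b.2 x))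
  (s.fin f, fun x => s.bw f (symbols i x) (b.2 x))

/-- A scan folds `Scan.step` over the list of implications. -/
theorem run_scan (s : Scan) (i d : Bool) (m : Mem) (b : (Bool × Bool) × (Fin n → Cell))
    (L : List (Implication (Fin n))) :
    Run (scan s i d) (scanMem m i d b.1 (stackList L) [] [] (word b.2) [])
      (scanMem m i d (L.foldl s.step b).1 [] (stackList L.reverse) []
        (word (L.foldl s.step b).2) [])
      (L.length * (6 * n + 9) + 2) := by
  have hfold : ∀ (l : List (Implication (Fin n))) b B,
      l.foldl (fun (b : ((Bool × Bool) × (Fin n → Cell)) × List (Implication (Fin n))) j =>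
        (s.step b.1 j, j :: b.2)) (b, B) = (l.foldl s.step b, l.reverse ++ B) := by
    intro l
    induction l with
    | nil => exact fun b B => rfl
    | cons j l ih => intro b B; simp [ih]
  refine Run.loop_foldl (T₀ := 1) (T₁ := 6 * n + 7)
    (fun (b : ((Bool × Bool) × (Fin n → Cell)) × List (Implication (Fin n))) l =>
      scanMem m i d b.1.1 (stackList l) (stackList b.2) [] (word b.1.2) [])
    (fun b j => (s.step b.1 j, j :: b.2))
    (fun b j l => { scanMem m i d b.1.1 (stackList (j :: l)) (stackList b.2) [] (word b.1.2) [] with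
      sym := (stackList (j :: l)).head? })
    (fun b => scanMem m i d b.1.1 (stackList (n := n) []) (stackList b.2) [] (word b.1.2) [])
    (fun b j l => .block (by cases i <;> cases d <;> rfl))
    (fun b j l => head?_stackList_cons j l) (fun b j l => ?_)
    (fun b => .block (by cases i <;> cases d <;> rfl))
    (fun b => by cases i <;> cases d <;> rfl) (b, []) L rfl ?_ (by
      have : 1 + 1 + (6 * n + 7) = 6 * n + 9 := by omega
      rw [this])
  · have h := run_scan_body s i d m b.1.1 (stackList l) (stackList b.2)
      (word fun x => (symbols j x, b.1.2 x)) _ rfl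
    rw [length_word] at h
    simp only [word, List.map_map, Function.comp_def] at h
    exact h
  · rw [hfold, List.append_nil]
    rfl

/-- The memory between the parts of the program: the base `L`, the result `O`, the implications `J`
that are still to be handled, the working word `w` and the flags `f`. -/
def state (L O J : List (Implication (Fin n))) (w : Fin n → Cell) (f : Bool × Bool) : Mem :=
  ⟨⟨none, none, none, none, none, f⟩, [], [], stackList L, [], stackList O, [], stackList J, [], [],
    word w, [], List.replicate n (), []⟩

/-- The working word that stores four sets and the marks. -/
def cells (C E T R : Finset (Fin n)) (todo cur : Fin n → Bool) (x : Fin n) : Cell :=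
  ⟨decide (x ∈ C), decide (x ∈ E), decide (x ∈ T), decide (x ∈ R), todo x, cur x⟩

variable {L O J : List (Implication (Fin n))} {C E T R : Finset (Fin n)} {todo cur : Fin n → Bool}

theorem run_scan_there_and_back (s : Scan) (b : (Bool × Bool) × (Fin n → Cell)) :
    Run (.seq (scan s true false) (scan s true true)) (state L O J b.2 b.1)
      (state L O J (O.reverse.foldl s.step (O.foldl s.step b)).2
        (O.reverse.foldl s.step (O.foldl s.step b)).1) (2 * (O.length * (6 * n + 9) + 2)) := by
  have h1 := run_scan s true false (state L O J b.2 b.1) b O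
  have h2 := run_scan s true true (state L O J b.2 b.1) (O.foldl s.step b) O.reverse
  rw [List.reverse_reverse, List.length_reverse] at h2
  exact (h1.seq h2).mono (by omega)

theorem run_pass_state (h : Bool × Bool → Cell → (Bool × Bool) × Cell) {w w' : Fin n → Cell}
    {f f' : Bool × Bool} (hw : mapFlag h f (word w) = (f', word w')) :
    Run (pass h) (state L O J w f) (state L O J w' f') (6 * n + 4) := by
  have := run_pass h (state L O J w f) rfl rfl
  simp only [state, hw, length_word] at this
  exact this

theorem mapFlag_of_flag_eq {h : Bool × Bool → Cell → (Bool × Bool) × Cell} {f : Bool × Bool}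
    {α : Type} {l : List α} {w w' : α → Cell} (hw : ∀ x ∈ l, h f (w x) = (f, w' x)) :
    mapFlag h f (l.map w) = (f, l.map w') := by
  induction l with
  | nil => rfl
  | cons x l ih =>
    simp only [List.forall_mem_cons] at hw
    simp [mapFlag, hw.1, ih hw.2]

theorem mapFlag_append (h : Bool × Bool → Cell → (Bool × Bool) × Cell) (f : Bool × Bool)
    (l l' : List Cell) : mapFlag h f (l ++ l') = ((mapFlag h (mapFlag h f l).1 l').1,
      (mapFlag h f l).2 ++ (mapFlag h (mapFlag h f l).1 l').2) := by
  induction l generalizing f with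
  | nil => rfl
  | cons y l ih => simp [mapFlag, ih]

/-! ### Saturation -/

/-- Fire an implication: the first flag says that its premise lies in `R`, the second one that the
guard allows it to fire. -/
def fireScan (g : Bool) : Scan where
  init _ := (true, !g)
  fw f p y := (f.1 && (!p.1 || y.r), f.2 || (y.e && !p.1))
  bw f p y := { y with r := y.r || (p.2 && (f.1 && f.2)) }
  fin _ := (false, false)

theorem foldl_and_or {α : Type} (l : List α) (p q : α → Bool) (a b : Bool) :
    l.foldl (fun (f : Bool × Bool) x => (f.1 && p x, f.2 || q x)) (a, b) =
      (a && l.all p, b || l.any q) := by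
  induction l generalizing a b with
  | nil => simp
  | cons x l ih => simp [ih, Bool.and_assoc, Bool.or_assoc]

/-- On the stored sets, a scan step is `fire`. -/
theorem fireScan_step (g : Bool) (f : Bool × Bool) (i : Implication (Fin n)) :
    (fireScan g).step (f, cells C E T R todo cur) i =
      ((false, false), cells C E T (fire g E R i) todo cur) := by
  have hflags : (fireScan g).flags f (word fun x => (symbols i x, cells C E T R todo cur x)) =
      (decide (i.premise ⊆ R), decide (g = true → ¬ E ⊆ i.premise)) := by
    rw [Scan.flags, word, List.foldl_map]
    refine (foldl_and_or _ _ _ _ _).trans (Prod.ext ?_ ?_)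
    · rw [Bool.true_and, Bool.eq_iff_iff, List.all_eq_true]
      simp [symbols, cells, Finset.subset_iff, ← imp_iff_not_or]
    · rw [Bool.eq_iff_iff, Bool.or_eq_true, List.any_eq_true]
      cases g <;> simp [symbols, cells, Finset.subset_iff]
  rw [Scan.step]
  simp only [hflags]
  refine Prod.ext rfl (funext fun x => ?_)
  simp only [fireScan, cells, symbols, fire]
  split_ifs with h
  · rw [← Bool.decide_and, decide_eq_true h]
    simp
  · rw [← Bool.decide_and, decide_eq_false h]
    simp

theorem fireScan_foldl (g : Bool) (l : List (Implication (Fin n))) :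
    l.foldl (fireScan g).step ((false, false), cells C E T R todo cur) =
      ((false, false), cells C E T (l.foldl (fire g E) R) todo cur) := by
  induction l generalizing R with
  | nil => rfl
  | cons i l ih => rw [List.foldl_cons, fireScan_step, ih, List.foldl_cons]

/-- Saturate the set `R`, with the unary counter as the number of passes. -/
def saturation (g : Bool) : Cmd Alph Reg :=
  .seq
    (.loop (.block [.pop .cnt fun r o => { r with tick := o }]) (fun r => r.tick.isSome)
      (.seq (.block [.push .cntR fun _ => (), .load Reg.clear])
        (.seq (scan (fireScan g) false false) (scan (fireScan g) false true))))
    (.loop (.block [.pop .cntR fun r o => { r with tick := o }]) (fun r => r.tick.isSome)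
      (.block [.push .cnt fun _ => (), .load Reg.clear]))

/-- A bound for the running time of `saturation` for `k` implications over `n` points. -/
def saturationTime (n k : ℕ) : ℕ := n * (2 * (k * (6 * n + 9) + 2) + 3) + 3 * n + 4

theorem run_firePass (g : Bool) (m : Mem)
    (hm : m = state L O J (cells C E T R todo cur) (false, false))
    (c c' : List Unit) :
    Run (.seq (scan (fireScan g) false false) (scan (fireScan g) false true))
      { m with cnt := c, cntR := c' }
      { state L O J (cells C E T (firePass g E L R) todo cur) (false, false) with
        cnt := c, cntR := c' } (2 * (L.length * (6 * n + 9) + 2)) := by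
  subst hm
  have h1 := run_scan (fireScan g) false false
    { state L O J (cells C E T R todo cur) (false, false) with cnt := c, cntR := c' }
    ((false, false), cells C E T R todo cur) L
  have h2 := run_scan (fireScan g) false true
    { state L O J (cells C E T R todo cur) (false, false) with cnt := c, cntR := c' }
    ((false, false), cells C E T (L.foldl (fire g E) R) todo cur) L.reverse
  rw [fireScan_foldl] at h1 h2
  rw [List.reverse_reverse, List.length_reverse] at h2
  exact (h1.seq h2).mono (by omega)

theorem run_saturation (g : Bool) :
    Run (saturation g) (state L O J (cells C E T R todo cur) (false, false))
      (state L O J (cells C E T (saturate n g E L R) todo cur) (false, false))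
      (saturationTime n L.length) := by
  have hfold : ∀ (l : List Unit) R c,
      l.foldl (fun (b : Finset (Fin n) × List Unit) u => (firePass g E L b.1, u :: b.2)) (R, c) =
        ((firePass g E L)^[l.length] R, l.reverse ++ c) := by
    intro l
    induction l with
    | nil => exact fun R c => rfl
    | cons u l ih => intro R c; simp [ih]
  refine Run.mono (Run.seq (T₁ := n * (2 * (L.length * (6 * n + 9) + 2) + 3) + 2)
    (T₂ := 3 * n + 2)
    (m₁ := { state L O J (cells C E T (saturate n g E L R) todo cur) (false, false) with
      cnt := [], cntR := List.replicate n () })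
    (Run.loop_foldl (T₀ := 1) (T₁ := 2 * (L.length * (6 * n + 9) + 2) + 1)
      (fun (b : Finset (Fin n) × List Unit) l =>
        { state L O J (cells C E T b.1 todo cur) (false, false) with cnt := l, cntR := b.2 })
      (fun b u => (firePass g E L b.1, u :: b.2))
      (fun b u l => { state L O J (cells C E T b.1 todo cur) (false, false) with
        tick := some u, cnt := l, cntR := b.2 })
      (fun b => { state L O J (cells C E T b.1 todo cur) (false, false) with
        cnt := [], cntR := b.2 })
      (fun _ _ _ => .block rfl) (fun _ _ _ => rfl)
      (fun b u l => ((Run.block rfl).seq (run_firePass g _ rfl l (u :: b.2))).mono (by omega))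
      (fun _ => .block rfl) (fun _ => rfl) (R, []) (List.replicate n ()) rfl ?_ ?_)
    (Run.loop_block
      (fun (b : List Unit) l =>
        { state L O J (cells C E T (saturate n g E L R) todo cur) (false, false) with
          cnt := b, cntR := l })
      (fun b u => u :: b) (fun _ _ _ => rfl) (fun _ _ _ => rfl) (fun _ => rfl)
      [] (List.replicate n ()) rfl ?_ ?_)) ?_
  · rw [hfold]
    simp only [List.length_replicate, List.reverse_replicate, List.append_nil]
    rfl
  · simp only [List.length_replicate]
    have : 1 + 1 + (2 * (L.length * (6 * n + 9) + 2) + 1) =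
      2 * (L.length * (6 * n + 9) + 2) + 3 := by omega
    rw [this]
  · rw [foldl_cons_map (fun u => u)]
    simp only [List.map_id', List.reverse_replicate, List.append_nil]
    rfl
  · simp
  · unfold saturationTime
    omega

end StackProgram

namespace StackProgram

variable {n : ℕ} {L O J : List (Implication (Fin n))} {C E T R : Finset (Fin n)}
  {todo cur : Fin n → Bool}

/-! ### The loop over the points -/

/-- Mark the first point that is still to be handled, if any, and initialize `R` for it. The first
flag says whether a point was found. -/
def selectCell (f : Bool × Bool) (y : Cell) : (Bool × Bool) × Cell :=
  if y.todo && !f.1 then ((true, f.2), { y with r := y.e, todo := false, cur := true })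
  else (f, { y with r := y.e || y.t, cur := false })

/-- Change `E` or, if `g` is set, `T` at the marked point. -/
def updateCell (g : Bool) (f : Bool × Bool) (y : Cell) : (Bool × Bool) × Cell :=
  (f, if y.cur then
    if g then { y with t := y.t && !y.r } else { y with e := y.e || (y.c && !y.r) } else y)

/-- The loop that computes `E` or, if `g` is set, `T`. -/
def pointLoop (g : Bool) : Cmd Alph Reg :=
  .loop (pass selectCell) (fun r => r.flag.1)
    (.seq (.block [.load fun r => { r with flag := (false, false) }])
      (.seq (saturation g) (pass (updateCell g))))

/-- One round of the loop over the points, on the sets `E` and `T`. -/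
def pointStep (g : Bool) (L : List (Implication (Fin n))) (C : Finset (Fin n))
    (b : Finset (Fin n) × Finset (Fin n)) (x : Fin n) : Finset (Fin n) × Finset (Fin n) :=
  if g then (b.1, shrinkStep L b.1 b.2 x)
  else (if x ∈ C ∧ x ∉ saturate n false b.1 L (b.1 ∪ b.2.erase x) then insert x b.1 else b.1, b.2)

theorem foldl_pointStep_true (l : List (Fin n)) (E T : Finset (Fin n)) :
    l.foldl (pointStep true L C) (E, T) = (E, l.foldl (shrinkStep L E) T) := by
  induction l generalizing T with
  | nil => rfl
  | cons x l ih => exact ih _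

theorem foldl_pointStep_false (l : List (Fin n)) (E : Finset (Fin n)) :
    l.foldl (pointStep false L C) (E, C) = (l.foldl (extremeStep L C) E, C) := by
  induction l generalizing E with
  | nil => rfl
  | cons x l ih => exact ih _

/-- When all points have been handled, no point is found. -/
theorem mapFlag_selectCell_nil :
    mapFlag selectCell (false, false) (word (cells C E T R (fun _ => false) cur)) =
      ((false, false), word (cells C E T (E ∪ T) (fun _ => false) fun _ => false)) := by
  refine mapFlag_of_flag_eq fun x _ => ?_
  simp [selectCell, cells]

/-- The first of the remaining points `x :: l` is found and marked. -/
theorem mapFlag_selectCell_cons {p l : List (Fin n)} {x : Fin n}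
    (h : List.finRange n = p ++ x :: l) :
    mapFlag selectCell (false, false) (word (cells C E T R (fun y => decide (y ∈ x :: l)) cur)) =
      ((true, false),
        word (cells C E T (E ∪ T.erase x) (fun y => decide (y ∈ l)) fun y => decide (y = x))) := by
  have hnd : (p ++ x :: l).Nodup := h ▸ List.nodup_finRange n
  rw [List.nodup_append] at hnd
  obtain ⟨-, hxl, hp⟩ := hnd
  have hxl := (List.nodup_cons.1 hxl).1
  simp only [word, h, List.map_append, List.map_cons]
  rw [mapFlag_append, mapFlag_of_flag_eq (f := (false, false))
    (w' := cells C E T (E ∪ T.erase x) (fun y => decide (y ∈ l)) fun y => decide (y = x))]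
  · rw [mapFlag]
    have hx : selectCell (false, false) (cells C E T R (fun y => decide (y ∈ x :: l)) cur x) =
        ((true, false), cells C E T (E ∪ T.erase x) (fun y => decide (y ∈ l))
          (fun y => decide (y = x)) x) := by
      simp [selectCell, cells, hxl]
    rw [hx, mapFlag_of_flag_eq (f := (true, false))
      (w' := cells C E T (E ∪ T.erase x) (fun y => decide (y ∈ l)) fun y => decide (y = x))]
    intro y hy
    have hyx : y ≠ x := fun e => hxl (e ▸ hy)
    simp [selectCell, cells, hyx]
  · intro y hy
    have hyx : y ≠ x := hp y hy x List.mem_cons_self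
    have hyl : y ∉ l := fun h => hp y hy y (List.mem_cons_of_mem _ h) rfl
    simp [selectCell, cells, hyx, hyl]

/-- The update at the marked point `x` carries out `pointStep`. -/
theorem mapFlag_updateCell (g : Bool) (x : Fin n) :
    mapFlag (updateCell g) (false, false)
      (word (cells C E T (saturate n g E L (E ∪ T.erase x)) todo fun y => decide (y = x))) =
      ((false, false), word (cells C (pointStep g L C (E, T) x).1 (pointStep g L C (E, T) x).2
        (saturate n g E L (E ∪ T.erase x)) todo fun y => decide (y = x))) := by
  refine mapFlag_of_flag_eq fun y _ => Prod.ext rfl ?_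
  cases g
  · simp only [updateCell, cells, pointStep, decide_eq_true_eq, Bool.false_eq_true, if_false]
    generalize saturate n false E L (E ∪ T.erase x) = S
    by_cases e : y = x
    · subst e
      by_cases hC : y ∈ C <;> by_cases hS : y ∈ S <;> simp [hC, hS]
    · rw [if_neg e]
      split_ifs <;> simp [e]
  · simp only [updateCell, cells, pointStep, shrinkStep, decide_eq_true_eq, if_true]
    generalize saturate n true E L (E ∪ T.erase x) = S
    by_cases e : y = x
    · subst e
      by_cases hS : y ∈ S <;> simp [hS]
    · rw [if_neg e]
      split_ifs <;> simp [e]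

/-- A bound for the running time of `pointLoop` for `k` implications over `n` points. -/
def pointLoopTime (n k : ℕ) : ℕ := n * (saturationTime n k + 12 * n + 10) + 6 * n + 5

theorem run_pointLoop (g : Bool) :
    Run (pointLoop g) (state L O J (cells C E T R (fun _ => true) cur) (false, false))
      (state L O J (cells C ((List.finRange n).foldl (pointStep g L C) (E, T)).1
        ((List.finRange n).foldl (pointStep g L C) (E, T)).2
        (((List.finRange n).foldl (pointStep g L C) (E, T)).1 ∪
          ((List.finRange n).foldl (pointStep g L C) (E, T)).2)
        (fun _ => false) fun _ => false) (false, false)) (pointLoopTime n L.length) := by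
  have key : ∀ (l p : List (Fin n)) (b : Finset (Fin n) × Finset (Fin n)) R cur,
      List.finRange n = p ++ l →
      Run (pointLoop g)
        (state L O J (cells C b.1 b.2 R (fun y => decide (y ∈ l)) cur) (false, false))
        (state L O J (cells C (l.foldl (pointStep g L C) b).1 (l.foldl (pointStep g L C) b).2
          ((l.foldl (pointStep g L C) b).1 ∪ (l.foldl (pointStep g L C) b).2)
          (fun _ => false) fun _ => false) (false, false))
        (l.length * (saturationTime n L.length + 12 * n + 10) + 6 * n + 5) := by
    intro l
    induction l with
    | nil =>
      intro p b R cur _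
      refine (Run.loop_exit (run_pass_state _ ?_) ?_).mono (T := 6 * n + 4 + 1) (by simp)
      · simpa using mapFlag_selectCell_nil
      · rfl
    | cons x l ih =>
      intro p b R cur hp
      refine (Run.loop_step (run_pass_state _ (mapFlag_selectCell_cons hp)) rfl
        ((Run.block rfl).seq ((run_saturation g).seq (run_pass_state _ (mapFlag_updateCell g x))))
        (ih (p ++ [x]) (pointStep g L C b x) _ _ (by simpa using hp))).mono ?_
      rw [List.length_cons, Nat.add_mul, Nat.one_mul]
      omega
  have h := key (List.finRange n) [] (E, T) R cur rfl
  simp only [List.mem_finRange, decide_true, List.length_finRange] at h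
  exact h

/-! ### Handling one implication -/

/-- Read the premise of the next implication into `R`. -/
def loadPremise : Cmd Alph Reg :=
  .seq (.loop (.block [.pop .job fun r o => { r with sym := o }]) Reg.isPair (.block
      [popWork, .push .workR fun r => ⟨false, false, false, r.theSym.1, true, false⟩,
        .load Reg.clear]))
    (.seq (.block [.load Reg.clear]) rewind)

theorem run_loadPremise (i : Implication (Fin n)) (w : Fin n → Cell) {m : Mem}
    (hm : state L O (i :: J) w (false, false) = m) :
    Run loadPremise m
      (state L O J (cells ∅ ∅ ∅ i.premise (fun _ => true) fun _ => false) (false, false))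
      (6 * n + 5) := by
  subst hm
  have h := run_rewind { state L O J w (false, false) with
    work := []
    workR := (word (cells ∅ ∅ ∅ i.premise (fun _ => true) fun _ => false)).reverse } rfl rfl
  simp only [List.reverse_reverse, List.length_reverse, length_word] at h
  refine Run.mono (Run.seq (T₁ := 3 * n + 2) (T₂ := 3 * n + 3)
    (m₁ := { state L O J w (false, false) with
      sym := some none
      work := []
      workR := (word (cells ∅ ∅ ∅ i.premise (fun _ => true) fun _ => false)).reverse })
    (Run.loop_block
      (fun (b : List Cell) (l : List (Fin n)) => { state L O J w (false, false) with
        job := stackWord (l.map (symbols i)) ++ stackList J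
        work := l.map w
        workR := b })
      (fun b x => cells ∅ ∅ ∅ i.premise (fun _ => true) (fun _ => false) x :: b)
      (fun b x l => ?_) (fun _ _ _ => rfl) (fun _ => rfl) [] (List.finRange n) rfl ?_ (by simp))
    (((Run.block rfl).seq h).mono (by omega))) (by omega)
  · simp [act, Mem.get, Mem.set, stackWord, popWork, Reg.theSym, symbols, state, Reg.clear, cells]
  · rw [foldl_cons_map, List.append_nil]
    rfl

/-- Compare an implication with the pair of `E` and `T`: the first flag says that they agree so
far, the second flag collects the outcomes. -/
def compareScan : Scan where
  init f := (true, f.2)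
  fw f p y := (f.1 && (p.1 == y.e && p.2 == y.t), f.2)
  bw _ _ y := y
  fin f := (false, f.2 || f.1)

theorem foldl_and {α : Type} (l : List α) (p : α → Bool) (a b : Bool) :
    l.foldl (fun (f : Bool × Bool) x => (f.1 && p x, f.2)) (a, b) = (a && l.all p, b) := by
  induction l generalizing a with
  | nil => simp
  | cons x l ih => simp [ih, Bool.and_assoc]

theorem compareScan_step (a b : Bool) (i : Implication (Fin n)) :
    compareScan.step ((a, b), cells C E T R todo cur) i =
      ((false, b || decide (i = ⟨E, T⟩)), cells C E T R todo cur) := by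
  have hflags : compareScan.flags (a, b) (word fun x => (symbols i x, cells C E T R todo cur x)) =
      (decide (i = ⟨E, T⟩), b) := by
    rw [Scan.flags, word, List.foldl_map]
    refine (foldl_and _ _ _ _).trans (Prod.ext ?_ rfl)
    rw [Bool.true_and, Bool.eq_iff_iff, List.all_eq_true]
    simp [symbols, cells, Implication.ext_iff, Finset.ext_iff, forall_and]
  rw [Scan.step]
  simp only [hflags]
  rfl

theorem compareScan_foldl (l : List (Implication (Fin n))) (b : Bool) :
    l.foldl compareScan.step ((false, b), cells C E T R todo cur) =
      ((false, b || decide (⟨E, T⟩ ∈ l)), cells C E T R todo cur) := by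
  induction l generalizing b with
  | nil => simp
  | cons i l ih =>
    rw [List.foldl_cons, compareScan_step, ih, Bool.or_assoc]
    simp [eq_comm]

/-- Add the implication with premise `E` and conclusion `T` to the result. -/
def emit : Cmd Alph Reg :=
  .seq (.block [.push (.lst true false) fun _ => none,
      .load fun r => { r with flag := (false, false) }])
    (.seq (passForward fun f y => (f, y))
      (.loop (.block [popWorkR]) (fun r => r.cell.isSome) (.block
        [.push .work Reg.theCell,
          .push (.lst true false) fun r => some (r.theCell.e, r.theCell.t), .load Reg.clear])))

theorem mapFlag_id (f : Bool × Bool) (l : List Cell) :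
    mapFlag (fun f y => (f, y)) f l = (f, l) := by
  induction l with
  | nil => rfl
  | cons y l ih => simp [mapFlag, ih]

theorem run_emit (f : Bool × Bool) :
    Run emit (state L O J (cells C E T R todo cur) f)
      (state L (⟨E, T⟩ :: O) J (cells C E T R todo cur) (false, false)) (6 * n + 5) := by
  have h := run_passForward (fun f y => (f, y))
    { state L O J (cells C E T R todo cur) (false, false) with
      res := none :: stackList O } rfl rfl
  simp only [mapFlag_id] at h
  refine Run.mono ((Run.block rfl).seq (h.seq (Run.loop_block (T := 3 * n + 2)
    (fun (b : List (Option (Bool × Bool)) × List Cell) (l : List Cell) =>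
      { state L O J (cells C E T R todo cur) (false, false) with
        res := b.1
        work := b.2
        workR := l })
    (fun b y => (some (y.e, y.t) :: b.1, y :: b.2))
    (fun _ _ _ => rfl) (fun _ _ _ => rfl) (fun _ => rfl) (none :: stackList O, [])
    (word (cells C E T R todo cur)).reverse rfl ?_ (by simp [length_word]))))
    (by simp only [state, length_word]; omega)
  have hfold : ∀ (l : List Cell) B w,
      l.foldl (fun (b : List (Option (Bool × Bool)) × List Cell) y =>
        (some (y.e, y.t) :: b.1, y :: b.2)) (B, w) =
      ((l.map fun y => some (y.e, y.t)).reverse ++ B, l.reverse ++ w) := by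
    intro l
    induction l with
    | nil => exact fun B w => rfl
    | cons y l ih => intro B w; simp [ih]
  rw [hfold]
  simp [act, popWorkR, Mem.get, Mem.set, state, stackList_cons, stackWord, word, symbols, cells,
    Function.comp_def]

/-- Compute the optimal implication for the closure of the next premise, and add it to the result
if it has a conclusion and is new. -/
def handle : Cmd Alph Reg :=
  .seq (.block [.load Reg.clear]) <|
  .seq loadPremise <|
  .seq (saturation false) <|
  .seq (pass fun f y => (f, { y with c := y.r, t := y.r })) <|
  .seq (pointLoop false) <|
  .seq (pass fun f y => (f, { y with todo := true })) <|
  .seq (pointLoop true) <|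
  .seq (pass fun f y => ((f.1 || y.t, f.2), y)) <|
  .seq (.block [.load fun r => { r with flag := (false, !r.flag.1) }]) <|
  .seq (.seq (scan compareScan true false) (scan compareScan true true)) <|
  .ite (fun r => r.flag.2) (.block [.load fun r => { r with flag := (false, false) }]) emit

theorem mapFlag_or {α : Type} (l : List α) (w : α → Cell) (b : Bool × Bool) :
    mapFlag (fun f y => ((f.1 || y.t, f.2), y)) b (l.map w) =
      ((b.1 || l.any fun x => (w x).t, b.2), l.map w) := by
  induction l generalizing b with
  | nil => simp [mapFlag]
  | cons x l ih => simp [mapFlag, ih, Bool.or_assoc]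

/-- A bound for the running time of `handle` with `k` implications in the base and `k'` in the
result. -/
def handleTime (n k k' : ℕ) : ℕ :=
  saturationTime n k + 2 * pointLoopTime n k + 2 * (k' * (6 * n + 9) + 2) + 30 * n + 25

theorem run_handle (i : Implication (Fin n)) (w : Fin n → Cell) {m : Mem}
    (hm : { state L O (i :: J) w (false, false) with sym := (stackList (i :: J)).head? } = m) :
    ∃ w', Run handle m (state L (addImplication L O i) J w' (false, false))
      (handleTime n L.length O.length) := by
  subst hm
  set C := closureOf L i.premise with hC
  have h1 := run_pointLoop (L := L) (O := O) (J := J) (C := C) (E := ∅) (T := C) (R := C)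
    (cur := fun _ => false) false
  rw [foldl_pointStep_false] at h1
  have h2 := run_pointLoop (L := L) (O := O) (J := J) (C := C) (E := extremes L C) (T := C)
    (R := extremes L C ∪ C) (cur := fun _ => false) true
  rw [foldl_pointStep_true] at h2
  have h3 : mapFlag (fun f y => ((f.1 || y.t, f.2), y)) (false, false)
      (word (cells C (extremes L C) (shrink L C (extremes L C))
        (extremes L C ∪ shrink L C (extremes L C)) (fun _ => false) fun _ => false)) =
      ((!decide (shrink L C (extremes L C) = ∅), false),
        word (cells C (extremes L C) (shrink L C (extremes L C))
        (extremes L C ∪ shrink L C (extremes L C)) (fun _ => false) fun _ => false)) := by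
    rw [word, mapFlag_or, Bool.false_or]
    refine Prod.ext (Prod.ext ?_ rfl) rfl
    rw [Bool.eq_iff_iff, List.any_eq_true]
    simp [cells, ← Finset.nonempty_iff_ne_empty, Finset.Nonempty]
  have h4 := run_scan_there_and_back (L := L) (O := O) (J := J) compareScan
    ((false, decide (shrink L C (extremes L C) = ∅)),
      cells C (extremes L C) (shrink L C (extremes L C))
        (extremes L C ∪ shrink L C (extremes L C)) (fun _ => false) fun _ => false)
  rw [compareScan_foldl, compareScan_foldl] at h4
  have h5 : (decide (shrink L C (extremes L C) = ∅) || decide ((⟨extremes L C,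
      shrink L C (extremes L C)⟩ : Implication (Fin n)) ∈ O) || decide ((⟨extremes L C,
      shrink L C (extremes L C)⟩ : Implication (Fin n)) ∈ O.reverse)) =
      decide ((optimalImplication L C).conclusion = ∅ ∨ optimalImplication L C ∈ O) := by
    rw [Bool.eq_iff_iff, decide_eq_true_iff]
    simp [optimalImplication]
  rw [h5] at h4
  have h6 := run_pass_state (L := L) (O := O) (J := J)
    (fun f y => (f, { y with c := y.r, t := y.r })) (f := (false, false))
    (mapFlag_of_flag_eq (l := List.finRange n) (w := cells ∅ ∅ ∅ C (fun _ => true) fun _ => false)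
      (w' := cells C ∅ C C (fun _ => true) fun _ => false) fun _ _ => rfl)
  have h7 := run_pass_state (L := L) (O := O) (J := J)
    (fun f y => (f, { y with todo := true })) (f := (false, false))
    (mapFlag_of_flag_eq (l := List.finRange n)
      (w := cells C (extremes L C) C (extremes L C ∪ C) (fun _ => false) fun _ => false)
      (w' := cells C (extremes L C) C (extremes L C ∪ C) (fun _ => true) fun _ => false)
      fun _ _ => rfl)
  refine ⟨cells C (extremes L C) (shrink L C (extremes L C))
    (extremes L C ∪ shrink L C (extremes L C)) (fun _ => false) fun _ => false, ?_⟩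
  refine Run.mono ((Run.block rfl).seq <| (run_loadPremise i w rfl).seq <|
    (run_saturation false).seq <|
    h6.seq <| h1.seq <| h7.seq <| h2.seq <| (run_pass_state _ h3).seq <|
    (Run.block (m' := state L O J (cells C (extremes L C) (shrink L C (extremes L C))
        (extremes L C ∪ shrink L C (extremes L C)) (fun _ => false) fun _ => false)
        (false, decide (shrink L C (extremes L C) = ∅))) ?_).seq <|
    h4.seq <| Run.ite (T := 6 * n + 5) ?_) ?_
  · simp [act, state]
  · simp only [state, addImplication, ← hC, decide_eq_true_eq]
    split_ifs with h
    · exact (Run.block rfl).mono (by omega)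
    · exact run_emit _
  · unfold handleTime
    omega

/-- Handle all implications. -/
def handleAll : Cmd Alph Reg :=
  .loop (.block [.peek .job fun r o => { r with sym := o }]) (fun r => r.sym.isSome) handle

theorem length_addImplication_le (i : Implication (Fin n)) :
    (addImplication L O i).length ≤ O.length + 1 := by
  unfold addImplication
  split_ifs <;> simp

theorem run_handleAll (J : List (Implication (Fin n))) (O : List (Implication (Fin n)))
    (w : Fin n → Cell) (k : ℕ) (hk : O.length + J.length ≤ k) :
    ∃ w', Run handleAll (state L O J w (false, false))
      (state L (J.foldl (addImplication L) O) [] w' (false, false))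
      (J.length * (handleTime n L.length k + 2) + 2) := by
  induction J generalizing O w with
  | nil => exact ⟨w, (Run.loop_exit (.block rfl) rfl).mono (T := 2) (by simp)⟩
  | cons i J ih =>
    obtain ⟨w₁, h₁⟩ := run_handle (L := L) (O := O) (J := J) i w rfl
    have hle := length_addImplication_le (L := L) (O := O) i
    rw [List.length_cons] at hk
    obtain ⟨w₂, h₂⟩ := ih (addImplication L O i) w₁ (by omega)
    have hT : handleTime n L.length O.length ≤ handleTime n L.length k := by
      unfold handleTime
      gcongr
      omega
    refine ⟨w₂, (Run.loop_step (.block rfl) (head?_stackList_cons i J) (h₁.mono hT) h₂).mono ?_⟩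
    rw [List.length_cons, Nat.add_mul, Nat.one_mul]
    omega

end StackProgram

namespace StackProgram

open Computability (Γ')

variable {n : ℕ} {L O : List (Implication (Fin n))} {w : Fin n → Cell}

/-! ### Reading the input -/

/-- The input symbol in the register marks a point of the ground set. -/
def Reg.isBlank (r : Reg) : Bool :=
  match r.chr with
  | some .blank => true
  | _ => false

/-- The input symbol in the register begins an implication. -/
def Reg.isBra (r : Reg) : Bool :=
  match r.chr with
  | some .bra => true
  | _ => false

/-- The input symbol in the register is a bit. -/
def Reg.isBit (r : Reg) : Bool :=
  match r.chr with
  | some (.bit _) => true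
  | _ => false

/-- The bit in the register. -/
def Reg.theBit (r : Reg) : Bool :=
  match r.chr with
  | some (.bit b) => b
  | _ => false

/-- Read an input symbol. -/
def popInp : Op Alph Reg := .pop .inp fun r o => { r with chr := o }

/-- Read the ground set into the counter, and prepare a working word of the same length. -/
def readGround : Cmd Alph Reg :=
  .seq (.loop (.block [.peek .inp fun r o => { r with chr := o }]) Reg.isBlank (.block
      [.pop .inp fun r _ => r, .push .cnt fun _ => (),
        .push .work fun _ => ⟨false, false, false, false, false, false⟩, .load Reg.clear]))
    (.block [.load Reg.clear])

/-- Read an implication and add it to the base and to the implications that are to be handled. -/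
def readImplication : Cmd Alph Reg :=
  .seq (.block [.load Reg.clear]) <|
  .seq (.loop (.block [popInp]) Reg.isBit (.block
    [.push .tmp fun r => (r.theBit, false), .load Reg.clear])) <|
  .seq (.block [.load Reg.clear]) <|
  .seq (.loop (.block [popInp]) Reg.isBit (.block
    [.push .aux fun r => (r.theBit, false), .load Reg.clear])) <|
  .seq (.block [.push (.lst false false) fun _ => none, .push .job fun _ => none,
    .load Reg.clear])
  (.loop (.block [popTmp]) (fun r => r.pair.isSome) (.block
    [.pop .aux fun r o => { r with pair := some (r.thePair.1, (o.getD (false, false)).1) },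
      .push (.lst false false) fun r => some r.thePair, .push .job fun r => some r.thePair,
      .load Reg.clear]))

/-- Read the list of implications. -/
def readBase : Cmd Alph Reg := .loop (.block [popInp]) Reg.isBra readImplication

/-- The working word that is prepared for the ground set. -/
def blankCell (_ : Fin n) : Cell := ⟨false, false, false, false, false, false⟩

theorem run_readGround (I : List Γ') (hI : I.head? ≠ some .blank) {m : Mem}
    (hm : { state (n := 0) [] [] [] blankCell (false, false) with
      inp := List.replicate n Γ'.blank ++ I } = m) :
    Run readGround m { state (n := n) [] [] [] blankCell (false, false) with inp := I }
      (3 * n + 3) := by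
  subst hm
  have hfold : ∀ (l c : List Unit) (w : List Cell),
      l.foldl (fun (b : List Unit × List Cell) u => (u :: b.1,
        (⟨false, false, false, false, false, false⟩ : Cell) :: b.2)) (c, w) =
        (l.reverse ++ c, (l.map fun _ =>
          (⟨false, false, false, false, false, false⟩ : Cell)).reverse ++ w) := by
    intro l
    induction l with
    | nil => exact fun c w => rfl
    | cons u l ih => intro c w; simp [ih]
  have hhead : ∀ r : Reg, { r with chr := I.head? }.isBlank = false := by
    intro r
    unfold Reg.isBlank
    split
    · exact absurd ‹_› hI
    · rfl
  refine Run.mono (Run.seq (T₁ := 3 * n + 2) (T₂ := 1)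
    (m₁ := { state (n := n) [] [] [] blankCell (false, false) with inp := I, chr := I.head? })
    (Run.loop_block
      (fun (b : List Unit × List Cell) (l : List Unit) =>
        { state (n := 0) [] [] [] blankCell (false, false) with
          inp := l.map (fun _ => Γ'.blank) ++ I, cnt := b.1, work := b.2 })
      (fun b u => (u :: b.1, (⟨false, false, false, false, false, false⟩ : Cell) :: b.2))
      (fun _ _ _ => rfl) (fun _ _ _ => rfl) (fun b => hhead _) ([], []) (List.replicate n ())
      ?_ ?_ (by simp)) (Run.block rfl)) (by omega)
  · simp [state, word]
  · rw [hfold]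
    have : word (n := n) blankCell =
        List.replicate n (⟨false, false, false, false, false, false⟩ : Cell) := by
      simp [word, blankCell, List.eq_replicate_iff]
    simp [act, Mem.get, state, this]
    rfl

theorem encodeSet_eq_map (A : Finset (Fin n)) :
    encodeSet A = (List.finRange n).map fun x => Γ'.bit (decide (x ∈ A)) :=
  List.ofFn_eq_map

theorem run_readImplication (i : Implication (Fin n)) (I : List Γ') {m : Mem}
    (hm : { state L O L w (false, false) with
      chr := some Γ'.bra
      inp := encodeSet i.premise ++ Γ'.comma :: encodeSet i.conclusion ++ Γ'.ket :: I } = m) :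
    Run readImplication m { state (i :: L) O (i :: L) w (false, false) with inp := I }
      (9 * n + 9) := by
  subst hm
  have h1 : Run (.block [.load Reg.clear]) { state L O L w (false, false) with
      chr := some Γ'.bra
      inp := encodeSet i.premise ++ Γ'.comma :: encodeSet i.conclusion ++ Γ'.ket :: I }
      { state L O L w (false, false) with
      inp := encodeSet i.premise ++ Γ'.comma :: encodeSet i.conclusion ++ Γ'.ket :: I } 1 :=
    .block rfl
  have h2 : Run (.loop (.block [popInp]) Reg.isBit (.block
      [.push .tmp fun r => (r.theBit, false), .load Reg.clear]))
      { state L O L w (false, false) with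
        inp := encodeSet i.premise ++ Γ'.comma :: encodeSet i.conclusion ++ Γ'.ket :: I }
      { state L O L w (false, false) with
        chr := some Γ'.comma
        inp := encodeSet i.conclusion ++ Γ'.ket :: I
        tmp := ((List.finRange n).map fun x => (decide (x ∈ i.premise), false)).reverse }
      (3 * n + 2) := by
    refine Run.loop_block
      (fun (b : List (Bool × Bool)) (l : List (Fin n)) => { state L O L w (false, false) with
        inp := l.map (fun x => Γ'.bit (decide (x ∈ i.premise))) ++
          Γ'.comma :: encodeSet i.conclusion ++ Γ'.ket :: I
        tmp := b })
      (fun b x => (decide (x ∈ i.premise), false) :: b)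
      (fun _ _ _ => rfl) (fun _ _ _ => rfl) (fun _ => rfl) [] (List.finRange n) ?_ ?_ (by simp)
    · rw [← encodeSet_eq_map]
      rfl
    · rw [foldl_cons_map, List.append_nil]
      rfl
  have h3 : Run (.loop (.block [popInp]) Reg.isBit (.block
      [.push .aux fun r => (r.theBit, false), .load Reg.clear]))
      { state L O L w (false, false) with
        inp := encodeSet i.conclusion ++ Γ'.ket :: I
        tmp := ((List.finRange n).map fun x => (decide (x ∈ i.premise), false)).reverse }
      { state L O L w (false, false) with
        chr := some Γ'.ket
        inp := I
        tmp := ((List.finRange n).map fun x => (decide (x ∈ i.premise), false)).reverse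
        aux := ((List.finRange n).map fun x => (decide (x ∈ i.conclusion), false)).reverse }
      (3 * n + 2) := by
    refine Run.loop_block
      (fun (b : List (Bool × Bool)) (l : List (Fin n)) => { state L O L w (false, false) with
        inp := l.map (fun x => Γ'.bit (decide (x ∈ i.conclusion))) ++ Γ'.ket :: I
        tmp := ((List.finRange n).map fun x => (decide (x ∈ i.premise), false)).reverse
        aux := b })
      (fun b x => (decide (x ∈ i.conclusion), false) :: b)
      (fun _ _ _ => rfl) (fun _ _ _ => rfl) (fun _ => rfl) [] (List.finRange n) ?_ ?_ (by simp)
    · rw [← encodeSet_eq_map]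
      rfl
    · rw [foldl_cons_map, List.append_nil]
      rfl
  have h4 : Run (.loop (.block [popTmp]) (fun r => r.pair.isSome) (.block
      [.pop .aux fun r o => { r with pair := some (r.thePair.1, (o.getD (false, false)).1) },
        .push (.lst false false) fun r => some r.thePair, .push .job fun r => some r.thePair,
        .load Reg.clear]))
      { state L O L w (false, false) with
        inp := I
        base := none :: stackList L
        job := none :: stackList L
        tmp := ((List.finRange n).map fun x => (decide (x ∈ i.premise), false)).reverse
        aux := ((List.finRange n).map fun x => (decide (x ∈ i.conclusion), false)).reverse }
      { state (i :: L) O (i :: L) w (false, false) with inp := I } (3 * n + 2) := by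
    refine Run.loop_block
      (fun (b : List (Option (Bool × Bool))) (l : List (Fin n)) =>
        { state L O L w (false, false) with
          inp := I
          base := b
          job := b
          tmp := l.map fun x => (decide (x ∈ i.premise), false)
          aux := l.map fun x => (decide (x ∈ i.conclusion), false) })
      (fun b x => some (symbols i x) :: b)
      (fun _ _ _ => rfl) (fun _ _ _ => rfl) (fun _ => rfl) (none :: stackList L)
      (List.finRange n).reverse ?_ ?_ (by simp)
    · rw [List.map_reverse, List.map_reverse]
    · rw [foldl_cons_map (symbols i · |> some), List.map_reverse, List.reverse_reverse]
      simp [act, popTmp, Mem.get, Mem.set, state, stackList_cons, stackWord, word,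
        Function.comp_def]
  exact (h1.seq <| h2.seq <| (Run.block rfl).seq <| h3.seq <|
    (Run.block rfl).seq h4).mono (by omega)

theorem run_readBase (L L' : List (Implication (Fin n))) {m : Mem}
    (hm : { state L' O L' w (false, false) with inp := L.flatMap encodeImplication } = m) :
    Run readBase m (state (L.reverse ++ L') O (L.reverse ++ L') w (false, false))
      (L.length * (9 * n + 11) + 2) := by
  subst hm
  induction L generalizing L' with
  | nil => exact (Run.loop_exit (.block rfl) rfl).mono (T := 2) (by simp)
  | cons i L ih =>
    have h := ih (i :: L')
    rw [List.reverse_cons, List.append_assoc]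
    refine (Run.loop_step (.block rfl) rfl
      (run_readImplication i (L.flatMap encodeImplication) ?_) h).mono ?_
    · simp [act, popInp, Mem.get, Mem.set, state, encodeImplication]
    · rw [List.length_cons, Nat.add_mul, Nat.one_mul]
      omega

/-! ### Writing the output -/

/-- Write an implication of the result, from its end to its beginning. -/
def writeImplication : Cmd Alph Reg :=
  .seq (.block [.push .out fun _ => Γ'.ket, .load Reg.clear]) <|
  .seq (.loop (.block [popLst true false]) Reg.isPair (.block
    [.push .tmp Reg.theSym, .load Reg.clear])) <|
  .seq (.block [.load Reg.clear]) <|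
  .seq (.loop (.block [popTmp]) (fun r => r.pair.isSome) (.block
    [.push .out fun r => Γ'.bit r.thePair.2, .push .aux Reg.thePair, .load Reg.clear])) <|
  .seq (.block [.push .out fun _ => Γ'.comma]) <|
  .seq (.loop (.block [.pop .aux fun r o => { r with pair := o }]) (fun r => r.pair.isSome) (.block
    [.push .tmp Reg.thePair, .load Reg.clear])) <|
  .seq (.loop (.block [popTmp]) (fun r => r.pair.isSome) (.block
    [.push .out fun r => Γ'.bit r.thePair.1, .load Reg.clear])) <|
  .block [.push .out fun _ => Γ'.bra]

/-- Write the result. -/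
def writeResult : Cmd Alph Reg :=
  .loop (.block [.peek (.lst true false) fun r o => { r with sym := o }]) (fun r => r.sym.isSome)
    writeImplication

/-- Write the ground set, and empty the remaining stacks. -/
def finish : Cmd Alph Reg :=
  .seq (.loop (.block [.pop .cnt fun r o => { r with tick := o }]) (fun r => r.tick.isSome)
    (.block [.push .out fun _ => Γ'.blank, .load Reg.clear])) <|
  .seq (.loop (.block [popLst false false]) (fun r => r.sym.isSome) (.block [.load Reg.clear]))
    (.loop (.block [popWork]) (fun r => r.cell.isSome) (.block [.load Reg.clear]))

theorem run_writeImplication (i : Implication (Fin n)) (o : List Γ') {m : Mem}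
    (hm : { state L (i :: O) [] w (false, false) with
      sym := (stackList (i :: O)).head?
      out := o } = m) :
    Run writeImplication m { state L O [] w (false, false) with out := encodeImplication i ++ o }
      (12 * n + 12) := by
  subst hm
  have h1 : Run (.loop (.block [popLst true false]) Reg.isPair (.block
      [.push .tmp Reg.theSym, .load Reg.clear]))
      { state L (i :: O) [] w (false, false) with out := Γ'.ket :: o }
      { state L O [] w (false, false) with
        sym := some none
        out := Γ'.ket :: o
        tmp := (word (symbols i)).reverse } (3 * n + 2) := by
    refine Run.loop_block
      (fun (b : List (Bool × Bool)) (l : List (Bool × Bool)) =>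
        { state L O [] w (false, false) with
          res := stackWord l ++ stackList O
          out := Γ'.ket :: o
          tmp := b })
      (fun b p => p :: b) (fun _ _ _ => rfl) (fun _ _ _ => rfl) (fun _ => rfl) []
      (word (symbols i)) rfl ?_ (by simp [length_word])
    rw [foldl_cons_map (fun p => p), List.map_id', List.append_nil]
    rfl
  have h2 : Run (.loop (.block [popTmp]) (fun r => r.pair.isSome) (.block
      [.push .out fun r => Γ'.bit r.thePair.2, .push .aux Reg.thePair, .load Reg.clear]))
      { state L O [] w (false, false) with
        out := Γ'.ket :: o
        tmp := (word (symbols i)).reverse }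
      { state L O [] w (false, false) with
        out := encodeSet i.conclusion ++ Γ'.ket :: o
        aux := word (symbols i) } (3 * n + 2) := by
    have hfold : ∀ (l : List (Bool × Bool)) (a : List Γ') (b : List (Bool × Bool)),
        l.foldl (fun (b : List Γ' × List (Bool × Bool)) p => (Γ'.bit p.2 :: b.1, p :: b.2)) (a, b) =
          ((l.map fun p => Γ'.bit p.2).reverse ++ a, l.reverse ++ b) := by
      intro l
      induction l with
      | nil => exact fun a b => rfl
      | cons p l ih => intro a b; simp [ih]
    refine Run.loop_block
      (fun (b : List Γ' × List (Bool × Bool)) (l : List (Bool × Bool)) =>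
        { state L O [] w (false, false) with
          out := b.1
          aux := b.2
          tmp := l })
      (fun b p => (Γ'.bit p.2 :: b.1, p :: b.2)) (fun _ _ _ => rfl) (fun _ _ _ => rfl)
      (fun _ => rfl) (Γ'.ket :: o, []) (word (symbols i)).reverse rfl ?_ (by simp [length_word])
    rw [hfold]
    simp [act, popTmp, Mem.get, Mem.set, state, word, symbols, encodeSet_eq_map, Function.comp_def]
  have h3 : Run (.loop (.block [.pop .aux fun r o => { r with pair := o }])
      (fun r => r.pair.isSome) (.block [.push .tmp Reg.thePair, .load Reg.clear]))
      { state L O [] w (false, false) with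
        out := Γ'.comma :: (encodeSet i.conclusion ++ Γ'.ket :: o)
        aux := word (symbols i) }
      { state L O [] w (false, false) with
        out := Γ'.comma :: (encodeSet i.conclusion ++ Γ'.ket :: o)
        tmp := (word (symbols i)).reverse } (3 * n + 2) := by
    refine Run.loop_block
      (fun (b : List (Bool × Bool)) (l : List (Bool × Bool)) =>
        { state L O [] w (false, false) with
          out := Γ'.comma :: (encodeSet i.conclusion ++ Γ'.ket :: o)
          tmp := b
          aux := l })
      (fun b p => p :: b) (fun _ _ _ => rfl) (fun _ _ _ => rfl) (fun _ => rfl) []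
      (word (symbols i)) rfl ?_ (by simp [length_word])
    rw [foldl_cons_map (fun p => p), List.map_id', List.append_nil]
    rfl
  have h4 : Run (.loop (.block [popTmp]) (fun r => r.pair.isSome) (.block
      [.push .out fun r => Γ'.bit r.thePair.1, .load Reg.clear]))
      { state L O [] w (false, false) with
        out := Γ'.comma :: (encodeSet i.conclusion ++ Γ'.ket :: o)
        tmp := (word (symbols i)).reverse }
      { state L O [] w (false, false) with
        out := encodeSet i.premise ++ Γ'.comma :: (encodeSet i.conclusion ++ Γ'.ket :: o) }
      (3 * n + 2) := by
    refine Run.loop_block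
      (fun (b : List Γ') (l : List (Bool × Bool)) =>
        { state L O [] w (false, false) with
          out := b
          tmp := l })
      (fun b p => Γ'.bit p.1 :: b) (fun _ _ _ => rfl) (fun _ _ _ => rfl)
      (fun _ => rfl) (Γ'.comma :: (encodeSet i.conclusion ++ Γ'.ket :: o))
      (word (symbols i)).reverse rfl ?_ (by simp [length_word])
    rw [foldl_cons_map (fun p : Bool × Bool => Γ'.bit p.1)]
    simp [act, popTmp, Mem.get, Mem.set, state, word, symbols, encodeSet_eq_map, Function.comp_def]
  refine ((Run.block rfl).seq <| h1.seq <| (Run.block rfl).seq <| h2.seq <| (Run.block rfl).seq <|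
    h3.seq <| h4.seq <| Run.block ?_).mono (by omega)
  simp [act, Mem.get, Mem.set, encodeImplication]

theorem run_writeResult (O : List (Implication (Fin n))) (o : List Γ') {m : Mem}
    (hm : { state L O [] w (false, false) with out := o } = m) :
    Run writeResult m { state L [] [] w (false, false) with
      out := O.reverse.flatMap encodeImplication ++ o } (O.length * (12 * n + 14) + 2) := by
  subst hm
  induction O generalizing o with
  | nil => exact (Run.loop_exit (.block rfl) rfl).mono (T := 2) (by simp)
  | cons i O ih =>
    have h := ih (encodeImplication i ++ o)
    rw [List.reverse_cons, List.flatMap_append, List.append_assoc, List.flatMap_singleton]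
    refine (Run.loop_step (.block rfl) (head?_stackList_cons i O)
      (run_writeImplication i o rfl) h).mono ?_
    rw [List.length_cons, Nat.add_mul, Nat.one_mul]
    omega

/-- The memory with empty stacks, except for the input and the output. -/
def ioMem (i o : List Γ') : Mem :=
  ⟨⟨none, none, none, none, none, (false, false)⟩, i, o, [], [], [], [], [], [], [], [], [], [], []⟩

theorem length_stackList (L : List (Implication (Fin n))) :
    (stackList L).length = L.length * (n + 1) := by
  induction L with
  | nil => simp [stackList]
  | cons i L ih =>
    rw [stackList_cons, List.length_append, ih, List.length_cons]
    simp only [stackWord, List.length_append, List.length_map, length_word, List.length_singleton]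
    ring

theorem run_finish (o : List Γ') :
    Run finish { state L [] [] w (false, false) with out := o }
      (ioMem [] (List.replicate n Γ'.blank ++ o)) (3 * (L.length * (n + 1)) + 6 * n + 6) := by
  refine Run.mono (Run.seq (T₁ := 3 * n + 2) (T₂ := 3 * (L.length * (n + 1)) + 3 * n + 4)
    (m₁ := { state L [] [] w (false, false) with out := List.replicate n Γ'.blank ++ o, cnt := [] })
    (Run.loop_block
      (fun (b : List Γ') (l : List Unit) => { state L [] [] w (false, false) with
        out := b
        cnt := l })
      (fun b _ => Γ'.blank :: b) (fun _ _ _ => rfl) (fun _ _ _ => rfl) (fun _ => rfl) o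
      (List.replicate n ()) rfl ?_ (by simp))
    (Run.mono (Run.seq (T₁ := 3 * (L.length * (n + 1)) + 2) (T₂ := 3 * n + 2)
      (m₁ := { state L [] [] w (false, false) with
        out := List.replicate n Γ'.blank ++ o
        cnt := []
        base := [] })
      (Run.loop_block
        (fun (_ : Unit) (l : List (Option (Bool × Bool))) => { state L [] [] w (false, false) with
          out := List.replicate n Γ'.blank ++ o
          cnt := []
          base := l })
        (fun b _ => b) (fun _ _ _ => rfl) (fun _ _ _ => rfl) (fun _ => rfl) ()
        (stackList L) rfl rfl (by rw [length_stackList]))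
      (Run.loop_block
        (fun (_ : Unit) (l : List Cell) => { state L [] [] w (false, false) with
          out := List.replicate n Γ'.blank ++ o
          cnt := []
          base := []
          work := l })
        (fun b _ => b) (fun _ _ _ => rfl) (fun _ _ _ => rfl) (fun _ => rfl) ()
        (word w) rfl rfl (by rw [length_word]))) (by omega))) (by omega)
  rw [foldl_cons_map (fun _ => Γ'.blank), List.map_const', List.length_replicate,
    List.reverse_replicate]
  rfl

/-! ### The machine -/

/-- The program that optimizes an implicational base. -/
def program : Cmd Alph Reg :=
  .seq readGround <| .seq readBase <| .seq handleAll <| .seq writeResult finish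

/-- A bound for the running time of `program` on `k` implications over `n` points. -/
def programTime (n k : ℕ) : ℕ :=
  k * (handleTime n k k + 24 * n + 30) + 3 * (k * (n + 1)) + 9 * n + 20

theorem length_foldl_addImplication_le (l : List (Implication (Fin n))) :
    (l.foldl (addImplication L) O).length ≤ O.length + l.length := by
  induction l generalizing O with
  | nil => simp
  | cons i l ih =>
    have h1 := length_addImplication_le (L := L) (O := O) i
    have h2 := ih (O := addImplication L O i)
    simp only [List.foldl_cons, List.length_cons]
    omega

theorem run_program (L : List (Implication (Fin n))) :
    Run program (ioMem (encodeBase ⟨n, L⟩) []) (ioMem [] (encodeBase ⟨n, optimize L⟩))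
      (programTime n L.length) := by
  have hhead : (L.flatMap encodeImplication).head? ≠ some Γ'.blank := by
    cases L <;> simp [encodeImplication]
  have h1 := run_readGround (n := n) (L.flatMap encodeImplication) hhead
    (m := ioMem (encodeBase ⟨n, L⟩) []) rfl
  have h2 := run_readBase (O := []) (w := blankCell) L [] rfl
  rw [List.append_nil] at h2
  obtain ⟨w, h3⟩ := run_handleAll (L := L.reverse) L.reverse [] blankCell L.length (by simp)
  rw [List.length_reverse] at h3
  have h4 := run_writeResult (L := L.reverse) (w := w)
    (L.reverse.foldl (addImplication L.reverse) []) [] rfl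
  rw [List.append_nil] at h4
  have h5 := run_finish (L := L.reverse) (w := w) ((optimize L).flatMap encodeImplication)
  rw [List.length_reverse] at h5
  have hlen := length_foldl_addImplication_le (L := L.reverse) (O := []) L.reverse
  simp only [List.length_nil, List.length_reverse, Nat.zero_add] at hlen
  have h4' := h4.mono (T' := L.length * (12 * n + 14) + 2) (by gcongr)
  refine (h1.seq <| h2.seq <| h3.seq <| h4'.seq h5).mono ?_
  unfold programTime
  ring_nf
  omega

/-- The Turing machine of the program. All its stack alphabets are finite, although `FinTM2` asks
for this only at the input stack. -/
noncomputable def machine : Turing.FinTM2 where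
  K := Stk
  k₀ := .inp
  k₁ := .out
  Γ := Alph
  Λ := Option program.Label
  main := some program.entry
  ΛFin := letI := program.fintypeLabel; inferInstance
  σ := Reg
  initialState := ⟨none, none, none, none, none, (false, false)⟩
  Γk₀Fin := inferInstanceAs (Fintype Γ')
  m := program.machine

theorem initList_machine (i : List Γ') : Turing.initList machine i =
    ⟨some (some program.entry), (ioMem i []).memory.1, (ioMem i []).memory.2⟩ := by
  refine congrArg (Turing.TM2.Cfg.mk _ _) (funext fun k => ?_)
  rcases k with _ | _ | ⟨_ | _, _ | _⟩ | _ | _ | _ | _ | _ | _ | _ <;> rfl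

theorem haltList_machine (o : List Γ') : Turing.haltList machine o =
    ⟨none, (ioMem [] o).memory.1, (ioMem [] o).memory.2⟩ := by
  refine congrArg (Turing.TM2.Cfg.mk _ _) (funext fun k => ?_)
  rcases k with _ | _ | ⟨_ | _, _ | _⟩ | _ | _ | _ | _ | _ | _ | _ <;> rfl

/-- The polynomial bound for the running time in terms of the length of the input. -/
noncomputable def timePolynomial : Polynomial ℕ :=
  let X : Polynomial ℕ := Polynomial.X
  let saturation := X * (2 * (X * (6 * X + 9) + 2) + 3) + 3 * X + 4
  let pointLoop := X * (saturation + 12 * X + 10) + 6 * X + 5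
  let handle := saturation + 2 * pointLoop + 2 * (X * (6 * X + 9) + 2) + 30 * X + 25
  X * (handle + 24 * X + 30) + 3 * (X * (X + 1)) + 9 * X + 20 + 1

theorem eval_timePolynomial (N : ℕ) : timePolynomial.eval N = programTime N N + 1 := by
  simp [timePolynomial, programTime, handleTime, pointLoopTime, saturationTime]

theorem programTime_mono {n k N : ℕ} (hn : n ≤ N) (hk : k ≤ N) :
    programTime n k ≤ programTime N N := by
  unfold programTime handleTime pointLoopTime saturationTime
  gcongr

theorem length_encodeBase (L : List (Implication (Fin n))) :
    n ≤ (encodeBase ⟨n, L⟩).length ∧ L.length ≤ (encodeBase ⟨n, L⟩).length := by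
  have h : L.length ≤ (L.flatMap encodeImplication).length := by
    induction L with
    | nil => simp
    | cons i L ih =>
      simp only [List.flatMap_cons, List.length_cons, List.length_append, encodeImplication]
      omega
  simp only [encodeBase, List.length_append, List.length_replicate]
  omega

/-- The optimization algorithm runs in polynomial time. -/
theorem nonempty_tm2ComputableInPolyTime_optimize :
    Nonempty (Turing.TM2ComputableInPolyTime encodeBase encodeBase
      fun b => ⟨b.1, optimize b.2⟩) := by
  refine ⟨{
    tm := machine
    inputAlphabet := Equiv.refl Γ'
    outputAlphabet := Equiv.refl Γ'
    time := timePolynomial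
    outputsFun := fun b => ?_ }⟩
  have hrun := run_program b.2
  refine Classical.choice ?_
  obtain ⟨t, ht, hexec⟩ := hrun
  have hsteps := hexec.steps_machine
  have hinit := (congrArg (Turing.initList machine) (List.map_id _)).trans
    (initList_machine (encodeBase b))
  have hhalt := (congrArg (Turing.haltList machine) (List.map_id _)).trans
    (haltList_machine (encodeBase ⟨b.1, optimize b.2⟩))
  refine ⟨⟨⟨t + 1, ?_⟩, ?_⟩⟩
  · refine (congrArg (fun c => (flip bind machine.step)^[t + 1] (some c)) hinit).trans ?_
    exact Eq.trans hsteps (congrArg some hhalt.symm)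
  · rw [eval_timePolynomial]
    have hle := length_encodeBase b.2
    exact Nat.add_le_add_right (ht.trans (programTime_mono hle.1 hle.2)) 1

end StackProgram

theorem theorem2 :
    (∃ f : (n : ℕ) → List (Implication (Fin n)) → List (Implication (Fin n)),
      Nonempty (Turing.TM2ComputableInPolyTime encodeBase encodeBase (fun b => ⟨b.1, f b.1 b.2⟩)) ∧
      ∀ (n : ℕ) (φ : ClosureOperator (Finset (Fin n))) (L : List (Implication (Fin n))),
        IsConvexGeometry φ → HasDisjointQCHypergraphs φ → IsBase φ L.toFinset →
          (f n L).Nodup ∧ IsOptimumBase φ (f n L).toFinset) ∧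
    (∀ (U : Type*) [Fintype U] [DecidableEq U] (φ : ClosureOperator (Finset U))
        (S : Finset (Implication U)),
      IsConvexGeometry φ → HasDisjointQCHypergraphs φ →
        IsMinimumBase φ S → IsLeftReduced φ S → IsRightReduced φ S → IsOptimumBase φ S) :=
  ⟨⟨fun _ L => optimize L, StackProgram.nonempty_tm2ComputableInPolyTime_optimize,
    fun _ _ _ hφ hdisj hL => ⟨nodup_optimize, isOptimumBase_optimize hφ hdisj hL⟩⟩,
    fun _ _ _ _ _ hφ hdisj hS hl hr => hS.isOptimumBase hφ hdisj hl hr⟩
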